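/- Let $p>3$ be a prime, $\mathbb{C}_p$ the completion of an algebraic closure of $\mathbb{Q}_p$ with $|p|_p=1/p$, and let $\chi$ be a primitive Dirichlet character of conductor $f$ with values in $\mathbb{C}_p$ (so $\chi(a)=0$ if $\gcd(a,f)>1$), where $p^2\nmid f$. Write $\chi_0$ for the principal character ($f=1$) and $F=\operatorname{lcm}(f,p)$. For $x,y,\gamma\in\mathbb{C}_p$, $\gamma\neq0$, write $x\equiv y \bmod \gamma$ if $|(x-y)/\gamma|_p\le 1$. For a primitive character $\psi$ of conductor $g$ define $B_{n,\psi}$ by $\sum_{n\ge0}B_{n,\psi}\frac{t^n}{n!}=\sum_{a=1}^{g}\frac{\psi(a)te^{at}}{e^{gt}-1}$, and let $\omega$ be the $p$-adic Teichmüller character; products such as $\chi\omega^{-n}$ denote the associated primitive characters. There is a unique function $L_p(s,\chi)$ on $\mathbb{Z}_p$ with values in $\mathbb{C}_p$ that is given by a convergent power series in $1-s$, apart from a simple pole at $s=1$ when $\chi=\chi_0$, and satisfies $$L_p(1-n,\chi)=-\bigl(1-\chi\omega^{-n}(p)p^{n-1}\bigr)\frac{B_{n,\chi\omega^{-n}}}{n}\qquad(n\ge1).$$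 Let $L_p(1-s,\chi)=\frac{a_{-1}}{s}+\sum_{i\ge0}a_is^i$ be its expansion. Then for all $s\in\mathbb{Z}_p$ (with $s\ne0$ if $\chi=\chi_0$; if $\chi\neq\chi_0$ the term $a_{-1}/s$ is absent) $$L_p(1-s,\chi)\equiv\frac{a_{-1}}{s}+a_0+a_1s \mod p^2 .$$ Here $a_{-1}=-\frac1F\sum_{1\le a\le F,\,p\nmid a}\chi(a)$, which is $0$ if $\chi\ne\chi_0$ and $\frac1p-1$ if $\chi=\chi_0$; moreover $|a_0|_p\le1$, $|a_1|_p<1$, and with $\mathcal{F}(a)=\frac{a^{p-1}-1}{p}$, $$a_0\equiv-\frac1F\sum_{\substack{a=1\\ p\nmid a}}^{F}\chi(a)\left(\frac1{p-1}\Bigl(p\mathcal{F}(a)-\frac{p^2\mathcal{F}(a)^2}{2}\Bigr)-\frac12\cdot\frac Fa-\frac1{12}\Bigl(\frac Fa\Bigr)^2\right)\mod p^2,$$ $$a_1\equiv-\frac1F\sum_{\substack{a=1\\ p\nmid a}}^{F}\chi(a)\left(\frac{p^2\mathcal{F}(a)^2}{2(p-1)^2}+\frac{F^2}{12a^2}-\frac{p\mathcal{F}(a)}{2(p-1)}\cdot\frac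 Fa\right)\mod p^2.$$ Consequently, if $\chi\ne\chi_0$, then for all integers $m,n$ $$L_p(1-m,\chi)\equiv L_p(1-n,\chi)\mod p,\qquad L_p(1-m,\chi)\equiv L_p(1-n,\chi)+a_1(m-n)\mod p^2 .$$ If $\chi=\chi_0$, the function $\zeta_p^*(1-s)=L_p(1-s,\chi_0)+\frac{R}{s}$, $R=1-p^{-1}$, extended to $s=0$ by its limit there, equals $\sum_{i\ge0}a_is^i$ for all $s\in\mathbb{Z}_p$, and both congruences hold for all integers $m,n$ with $L_p(\cdot,\chi)$ replaced by $\zeta_p^*$. -/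

import Mathlib

open Filter Topology

noncomputable section

/-- `x ≡ y mod γ` for `p`-adic complex numbers: the quotient `(x - y) / γ` is `p`-integral. -/
def PadicCongr (p : ℕ) [Fact p.Prime] (x y γ : ℂ_[p]) : Prop :=
  ‖(x - y) / γ‖ ≤ 1

/-- The inclusion `ℤ_p ⊆ ℂ_p`. -/
def toCp (p : ℕ) [Fact p.Prime] (s : ℤ_[p]) : ℂ_[p] :=
  algebraMap ℚ_[p] ℂ_[p] (s : ℚ_[p])

/-! ### Generalized Bernoulli numbers -/

/-- The formal power series `(e^{ft} - 1) / t`. -/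
def expSubOneDivT (K : Type*) [Field K] [CharZero K] (f : ℕ) : PowerSeries K :=
  PowerSeries.mk fun n => PowerSeries.coeff (n + 1)
    (PowerSeries.rescale (f : K) (PowerSeries.exp K))

/-- The formal power series `∑_{a=1}^f χ(a) t e^{at} / (e^{ft} - 1)` of a Dirichlet
character `χ` of level `f ≥ 1`. -/
def genBernoulliSeries {K : Type*} [Field K] [CharZero K] {f : ℕ}
    (χ : DirichletCharacter K f) : PowerSeries K :=
  (∑ a ∈ Finset.Icc 1 f, PowerSeries.C (χ (a : ZMod f)) *
    PowerSeries.rescale (a : K) (PowerSeries.exp K)) * (expSubOneDivT K f)⁻¹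

/-- The generalized Bernoulli number `B_{n,χ}`, defined by
`∑_{n ≥ 0} B_{n,χ} tⁿ / n! = ∑_{a=1}^f χ(a) t e^{at} / (e^{ft} - 1)`. -/
def genBernoulli {K : Type*} [Field K] [CharZero K] {f : ℕ}
    (χ : DirichletCharacter K f) (n : ℕ) : K :=
  (n.factorial : K) * PowerSeries.coeff n (genBernoulliSeries χ)

/-- The series `(e^{ft} - 1) / t` times `t` is `e^{ft} - 1`. -/
theorem X_mul_expSubOneDivT (K : Type*) [Field K] [CharZero K] (f : ℕ) :
    PowerSeries.X * expSubOneDivT K f =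
      PowerSeries.rescale (f : K) (PowerSeries.exp K) - 1 := by
  ext n
  cases n with
  | zero =>
    rw [PowerSeries.coeff_zero_X_mul, map_sub, PowerSeries.coeff_rescale, PowerSeries.coeff_exp]
    simp
  | succ n => simp [expSubOneDivT, PowerSeries.coeff_succ_X_mul, PowerSeries.coeff_one]

/-- The defining identity of the generating series, with denominators cleared. -/
theorem genBernoulliSeries_mul {K : Type*} [Field K] [CharZero K] {f : ℕ} [NeZero f]
    (χ : DirichletCharacter K f) :
    genBernoulliSeries χ * (PowerSeries.rescale (f : K) (PowerSeries.exp K) - 1) =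
      ∑ a ∈ Finset.Icc 1 f, PowerSeries.C (χ (a : ZMod f)) * PowerSeries.X *
        PowerSeries.rescale (a : K) (PowerSeries.exp K) := by
  have h : PowerSeries.constantCoeff (expSubOneDivT K f) ≠ 0 := by
    rw [← PowerSeries.coeff_zero_eq_constantCoeff_apply]
    simp [expSubOneDivT, PowerSeries.coeff_exp, NeZero.ne f]
  rw [← X_mul_expSubOneDivT, genBernoulliSeries, mul_assoc, mul_left_comm _ PowerSeries.X,
    PowerSeries.inv_mul_cancel _ h, mul_one, Finset.sum_mul]
  exact Finset.sum_congr rfl fun a _ => by ring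

/-! ### The Teichmüller character -/

/-- The Teichmüller representative in `ℤ_p` of a residue class modulo `p`. -/
def teichmullerRep (p : ℕ) [Fact p.Prime] : ZMod p →* ℤ_[p] :=
  ((WittVector.equiv p : WittVector p (ZMod p) →+* ℤ_[p]) : WittVector p (ZMod p) →* ℤ_[p]).comp
    (WittVector.teichmuller p)

/-- The Teichmüller character `ω`, as a Dirichlet character modulo `p` with values in `ℂ_p`. -/
def teichmullerChar (p : ℕ) [Fact p.Prime] : DirichletCharacter ℂ_[p] p where
  toFun a := toCp p (teichmullerRep p a)
  map_one' := by simp [toCp]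
  map_mul' a b := by simp [toCp]
  map_nonunit' a ha := by
    have : a = 0 := by simpa using ha
    subst this
    simp [toCp, teichmullerRep, WittVector.teichmuller_zero]

/-- `ω(a)` is a `(p-1)`-st root of unity. -/
theorem teichmullerRep_pow (p : ℕ) [Fact p.Prime] (a : ZMod p) (ha : a ≠ 0) :
    teichmullerRep p a ^ (p - 1) = 1 := by
  rw [← map_pow, ZMod.pow_card_sub_one_eq_one ha, map_one]

/-- `ω(a) ≡ a` modulo `p`. -/
theorem toZMod_teichmullerRep (p : ℕ) [Fact p.Prime] (a : ZMod p) :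
    PadicInt.toZMod (teichmullerRep p a) = a := by
  have key : ∀ g : ℤ_[p] →+* ZMod p, g = PadicInt.toZMod := by
    intro g
    ext x
    have hx : x - (x.zmodRepr : ℤ_[p]) ∈ IsLocalRing.maximalIdeal ℤ_[p] :=
      PadicInt.sub_zmodRepr_mem x
    rw [PadicInt.maximalIdeal_eq_span_p, Ideal.mem_span_singleton] at hx
    obtain ⟨y, hy⟩ := hx
    rw [sub_eq_iff_eq_add] at hy
    rw [hy]
    simp
  have h := RingHom.congr_fun
    (key ((WittVector.constantCoeff : WittVector p (ZMod p) →+* ZMod p).comp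
      ((WittVector.equiv p).symm : ℤ_[p] →+* WittVector p (ZMod p)))) (teichmullerRep p a)
  rw [← h]
  simp [teichmullerRep, WittVector.constantCoeff_apply]

/-! ### The Kubota--Leopoldt `p`-adic `L`-function -/

/-- The primitive Dirichlet character attached to `χ ω⁻ⁿ`. -/
def teichmullerTwist (p : ℕ) [Fact p.Prime] {f : ℕ} (χ : DirichletCharacter ℂ_[p] f) (n : ℕ) :
    DirichletCharacter ℂ_[p] (χ.mul ((teichmullerChar p)⁻¹ ^ n)).conductor :=
  (χ.mul ((teichmullerChar p)⁻¹ ^ n)).primitiveCharacter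

/-- `L(1 - s) = c / s + ∑_{i ≥ 0} a_i s^i` on `ℤ_p`: the function `L : ℤ_p → ℂ_p` is given by a
convergent power series in `1 - s`, apart from a possible simple pole at `1` (that is, if `c ≠ 0`).
Where `L` has a pole it gets the value `0`. -/
def HasLaurentExpansionAtOne (p : ℕ) [Fact p.Prime] (L : ℤ_[p] → ℂ_[p]) (c : ℂ_[p])
    (a : ℕ → ℂ_[p]) : Prop :=
  (∀ s : ℤ_[p], (s ≠ 0 ∨ c = 0) →
    HasSum (fun i : ℕ => a i * toCp p s ^ i) (L (1 - s) - c / toCp p s)) ∧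
  (c ≠ 0 → L 1 = 0)

/-- `L : ℤ_p → ℂ_p` is the Kubota--Leopoldt `p`-adic `L`-function of `χ`: it is meromorphic,
analytic except for a simple pole at `1` if `χ` is principal, and for all `n ≥ 1`
`L(1 - n) = -(1 - χω⁻ⁿ(p) p^{n-1}) B_{n,χω⁻ⁿ} / n`. -/
structure IsKubotaLeopoldt (p : ℕ) [Fact p.Prime] {f : ℕ} (χ : DirichletCharacter ℂ_[p] f)
    (L : ℤ_[p] → ℂ_[p]) : Prop where
  meromorphic : ∃ (c : ℂ_[p]) (a : ℕ → ℂ_[p]), HasLaurentExpansionAtOne p L c a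
  analytic_of_ne_one : χ ≠ 1 → ∃ a : ℕ → ℂ_[p], HasLaurentExpansionAtOne p L 0 a
  interpolation : ∀ n : ℕ, 1 ≤ n →
    L (1 - (n : ℤ_[p])) =
      -(1 - teichmullerTwist p χ n (p : ZMod _) * (p : ℂ_[p]) ^ (n - 1)) *
        (genBernoulli (teichmullerTwist p χ n) n / (n : ℂ_[p]))

/-- The Kubota--Leopoldt `p`-adic `L`-function `L_p(s, χ)`: the function with the properties
listed in `IsKubotaLeopoldt`. -/
def kubotaLeopoldt (p : ℕ) [Fact p.Prime] {f : ℕ} (χ : DirichletCharacter ℂ_[p] f) :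
    ℤ_[p] → ℂ_[p] :=
  Classical.epsilon (IsKubotaLeopoldt p χ)

open scoped Classical in
/-- The modified `p`-adic zeta function `ζ_p^*(1 - s) = L_p(1 - s, χ₀) + R / s` with
`R = 1 - 1/p`, extended to the point `1` by its limit there. -/
def padicZetaStar (p : ℕ) [Fact p.Prime] (u : ℤ_[p]) : ℂ_[p] :=
  let g : ℤ_[p] → ℂ_[p] := fun v =>
    kubotaLeopoldt p (1 : DirichletCharacter ℂ_[p] 1) v + (1 - (p : ℂ_[p])⁻¹) / toCp p (1 - v)
  if u = 1 then limUnder (𝓝[≠] (1 : ℤ_[p])) g else g u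

/-! ### The explicit sums -/

/-- The Fermat quotient `(a^{p-1} - 1) / p`, as an element of `ℂ_p`. -/
def fermatQuot (p : ℕ) [Fact p.Prime] (a : ℕ) : ℂ_[p] :=
  ((a : ℂ_[p]) ^ (p - 1) - 1) / p

/-- The normalized sum `-(1/F) ∑_{1 ≤ a ≤ F, p ∤ a} χ(a) h(a)` with `F = lcm(f, p)`. -/
def restrictedAverage (p : ℕ) [Fact p.Prime] {f : ℕ} (χ : DirichletCharacter ℂ_[p] f)
    (h : ℕ → ℂ_[p]) : ℂ_[p] :=
  -(1 / (Nat.lcm f p : ℂ_[p])) *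
    ∑ a ∈ (Finset.Icc 1 (Nat.lcm f p)).filter (fun a => ¬ p ∣ a), χ (a : ZMod f) * h a

end

/-!
With `F = lcm(f, p)`, `⟨a⟩ = a / ω(a)` and Bernoulli numbers `B_j`, the `p`-adic `L`-function is
`s L_p(1 - s, χ) = -(1/F) ∑_{a ≤ F, p ∤ a} χ(a) ⟨a⟩^s ∑_j C(s, j) B_j (F / a)^j`.
Expanding `⟨a⟩^s = ∑_k C(s, k) (⟨a⟩ - 1)^k` makes the right hand side a double series, over pairs
`(k, j)`, of polynomials in `s` (`numeratorPoly`). No `p`-adic exponential or logarithm is needed.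

* Convergence. The coefficients of the `(k, j)`-th polynomial are bounded by
  `p |p^k / k!| |B_j p^j / j!|`, which is a null family by Legendre's formula for `v_p(k!)` and
  `|p B_j| ≤ 1` (von Staudt--Clausen). So the series can be rearranged into a power series in `s`
  on the closed unit disc (`hasSum_tsum_coeff_mul_pow`), and dividing by `s` gives the Laurent
  expansion.
* Interpolation. At `s = n ≥ 1` the series is finite: the sum over `k` is `⟨a⟩ⁿ` and the sum over
  `j` is `Fⁿ B_n(a / F) / aⁿ`. The distribution relation `mul_genBernoulli` for generalized
  Bernoulli numbers evaluates the average over `a`, and leaving out the multiples of `p` produces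
  the Euler factor (`sum_filter_mul_homBernoulli`). For `p ∤ a` the product `χ(a) ω(a)⁻ⁿ` is the
  value of the primitive character, even at `a` not prime to `f` (`primitiveCharacter_mul_apply`).
* Uniqueness. A power series that vanishes at all `p ^ k` is zero (`eq_zero_of_hasSum_zero`).
* Congruences. As `p ^ 2 ∤ F`, the factor `1 / F` costs one power of `p`; as `p > 3`, and as
  `B_3 = 0`, each term with `k + j ≥ 3` is divisible by `p ^ 3` before that division. Hence only
  the six terms with `k + j ≤ 2` matter modulo `p ^ 2`, and they are of degree at most `2` in `s`.
  They are written with `y = ⟨a⟩ - 1`; the Fermat quotient `𝓕(a) = (a^{p-1} - 1) / p` enters through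
  `a^{p-1} = ⟨a⟩^{p-1} = (1 + y)^{p-1}`, which gives
  `(p 𝓕(a) - p² 𝓕(a)² / 2) / (p - 1) ≡ y - y² / 2` modulo `p ^ 3`.
-/

noncomputable section

/-! ### Power series over complete ultrametric fields -/

section Ultrametric

variable {K : Type*} [NormedField K] [IsUltrametricDist K]

/-- A sum of polynomials whose coefficients are uniformly dominated by a null family may be
rearranged into a single power series on the closed unit disc. -/
theorem hasSum_tsum_coeff_mul_pow [CompleteSpace K] {ι : Type*} {P : ι → Polynomial K} {r : ι → ℝ}
    (hr : Tendsto r cofinite (𝓝 0)) (hP : ∀ k i, ‖(P k).coeff i‖ ≤ r k) {s : K} (hs : ‖s‖ ≤ 1) :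
    HasSum (fun i : ℕ => (∑' k, (P k).coeff i) * s ^ i) (∑' k, (P k).eval s) := by
  set t : ι × ℕ → K := fun x => (P x.1).coeff x.2 * s ^ x.2 with ht
  have hle : ∀ k i, ‖(P k).coeff i * s ^ i‖ ≤ r k := fun k i => by
    rw [norm_mul, norm_pow]
    exact (mul_le_of_le_one_right (norm_nonneg _) (pow_le_one₀ (norm_nonneg _) hs)).trans (hP k i)
  have hsum : Summable t := by
    apply NonarchimedeanAddGroup.summable_of_tendsto_cofinite_zero
    rw [Metric.tendsto_nhds]
    intro ε hε
    have hfin : {k | ¬ r k < ε}.Finite := hr.eventually (gt_mem_nhds hε)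
    refine (hfin.biUnion (t := fun k => (fun i => (k, i)) '' ((P k).support : Set ℕ))
      fun k _ => (Finset.finite_toSet _).image _).subset ?_
    rintro ⟨k, i⟩ hki
    simp only [Set.mem_compl_iff, Set.mem_ofPred_eq, dist_zero_right] at hki
    simp only [Set.mem_iUnion, Set.mem_image]
    refine ⟨k, fun h => hki ((hle k i).trans_lt h), i, ?_, rfl⟩
    simp only [Finset.mem_coe, Polynomial.mem_support_iff]
    intro h0
    exact hki (by simpa [ht, h0] using hε)
  have hrow : ∀ k, HasSum (fun i => t (k, i)) ((P k).eval s) := fun k => by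
    rw [Polynomial.eval_eq_sum]
    exact hasSum_sum_of_ne_finset_zero fun i hi => by
      simp [ht, Polynomial.notMem_support_iff.mp hi]
  have hcol : ∀ i, HasSum (fun k => t (k, i)) ((∑' k, (P k).coeff i) * s ^ i) := fun i => by
    have hc : Summable fun k => (P k).coeff i :=
      NonarchimedeanAddGroup.summable_of_tendsto_cofinite_zero
        (squeeze_zero_norm (fun k => hP k i) hr)
    exact hc.hasSum.mul_right _
  rw [(hsum.hasSum.prod_fiberwise hrow).tsum_eq]
  exact ((Equiv.prodComm ℕ ι).hasSum_iff.mpr hsum.hasSum).prod_fiberwise hcol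

/-- Identity principle: a power series that converges on the closed unit disc and vanishes along a
sequence of nonzero points tending to `0` is zero. -/
theorem eq_zero_of_hasSum_zero {b : ℕ → K} (hb : Summable b) {u : ℕ → K}
    (hu0 : ∀ k, u k ≠ 0) (hu1 : ∀ k, ‖u k‖ ≤ 1) (hu : Tendsto u atTop (𝓝 0))
    (h : ∀ k, HasSum (fun i => b i * u k ^ i) 0) : b = 0 := by
  obtain ⟨M, hM⟩ : ∃ M, ∀ i, ‖b i‖ ≤ M := by
    obtain ⟨M, hM⟩ := hb.tendsto_atTop_zero.norm.bddAbove_range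
    exact ⟨M, fun i => hM ⟨i, rfl⟩⟩
  have hM0 : 0 ≤ M := (norm_nonneg _).trans (hM 0)
  funext N
  induction N using Nat.strong_induction_on with
  | _ N ih =>
  have key : ∀ k, ‖b N‖ ≤ M * ‖u k‖ := fun k => by
    have h1 : HasSum (fun i => b (i + (N + 1)) * u k ^ (i + (N + 1))) (-(b N * u k ^ N)) := by
      rw [hasSum_nat_add_iff (f := fun i => b i * u k ^ i), Finset.sum_range_succ,
        Finset.sum_eq_zero fun i hi => by simp [ih i (Finset.mem_range.mp hi)]]
      simpa using h k
    have h2 : ‖b N * u k ^ N‖ ≤ M * ‖u k‖ ^ (N + 1) := by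
      rw [← norm_neg, ← h1.tsum_eq]
      refine IsUltrametricDist.norm_tsum_le_of_forall_le_of_nonneg (by positivity) fun i => ?_
      rw [norm_mul, norm_pow]
      exact mul_le_mul (hM _) (pow_le_pow_of_le_one (norm_nonneg _) (hu1 k) (by omega))
        (by positivity) hM0
    rw [norm_mul, norm_pow, pow_succ', ← mul_assoc] at h2
    exact le_of_mul_le_mul_right h2 (pow_pos (norm_pos_iff.mpr (hu0 k)) N)
  have hlim : Tendsto (fun k => M * ‖u k‖) atTop (𝓝 0) := by
    simpa using hu.norm.const_mul M
  exact norm_le_zero_iff.mp (ge_of_tendsto' hlim key)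

theorem norm_add_le_of_ultrametric {x y : K} {r : ℝ} (hx : ‖x‖ ≤ r) (hy : ‖y‖ ≤ r) : ‖x + y‖ ≤ r :=
  (IsUltrametricDist.norm_add_le_max x y).trans (max_le hx hy)

theorem norm_sub_le_of_ultrametric {x y : K} {r : ℝ} (hx : ‖x‖ ≤ r) (hy : ‖y‖ ≤ r) : ‖x - y‖ ≤ r :=
  sub_eq_add_neg x y ▸ norm_add_le_of_ultrametric hx ((norm_neg y).trans_le hy)

end Ultrametric

/-! ### The absolute value of `ℂ_p` on integers and factorials -/

section Norms

variable (p : ℕ) [hp : Fact p.Prime]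

theorem toCp_eq_ringHom (s : ℤ_[p]) :
    toCp p s = ((algebraMap ℚ_[p] ℂ_[p]).comp (PadicInt.Coe.ringHom (p := p))) s := rfl

@[simp] theorem toCp_natCast (n : ℕ) : toCp p n = n := by simp [toCp_eq_ringHom]
@[simp] theorem toCp_intCast (n : ℤ) : toCp p n = n := by simp [toCp_eq_ringHom]
@[simp] theorem toCp_zero : toCp p 0 = 0 := by simp [toCp_eq_ringHom]
@[simp] theorem toCp_one : toCp p 1 = 1 := by simp [toCp_eq_ringHom]
theorem toCp_sub (s t : ℤ_[p]) : toCp p (s - t) = toCp p s - toCp p t := by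
  simp [toCp_eq_ringHom]
theorem toCp_pow (s : ℤ_[p]) (n : ℕ) : toCp p (s ^ n) = toCp p s ^ n := by
  simp [toCp_eq_ringHom]

@[simp] theorem norm_toCp (s : ℤ_[p]) : ‖toCp p s‖ = ‖s‖ := by
  rw [toCp, norm_algebraMap', PadicInt.norm_def]

theorem norm_toCp_le_one (s : ℤ_[p]) : ‖toCp p s‖ ≤ 1 := by
  rw [norm_toCp]; exact PadicInt.norm_le_one s

theorem toCp_eq_zero {s : ℤ_[p]} : toCp p s = 0 ↔ s = 0 := by
  rw [← norm_eq_zero, norm_toCp, norm_eq_zero]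

theorem norm_natCast_le_one (n : ℕ) : ‖(n : ℂ_[p])‖ ≤ 1 := by
  rw [← toCp_natCast]; exact norm_toCp_le_one p _

theorem norm_intCast_le_one (n : ℤ) : ‖(n : ℂ_[p])‖ ≤ 1 := by
  rw [← toCp_intCast]; exact norm_toCp_le_one p _

theorem norm_p : ‖(p : ℂ_[p])‖ = (p : ℝ)⁻¹ := by
  rw [← toCp_natCast, norm_toCp, PadicInt.norm_p]

theorem norm_natCast_eq_one {n : ℕ} (h : ¬ p ∣ n) : ‖(n : ℂ_[p])‖ = 1 := by
  rw [← toCp_natCast, norm_toCp, PadicInt.norm_def, PadicInt.coe_natCast]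
  exact Padic.norm_natCast_eq_one_iff.mpr ((Nat.Prime.coprime_iff_not_dvd hp.out).mpr h)

theorem norm_natCast_of_dvd {n : ℕ} (h : p ∣ n) (h2 : ¬ p ^ 2 ∣ n) :
    ‖(n : ℂ_[p])‖ = (p : ℝ)⁻¹ := by
  obtain ⟨m, rfl⟩ := h
  have hm : ¬ p ∣ m := fun hm => h2 (by rw [sq]; exact mul_dvd_mul_left p hm)
  rw [Nat.cast_mul, norm_mul, norm_p, norm_natCast_eq_one p hm, mul_one]

theorem norm_natCast_eq_pow {n : ℕ} (h : n ≠ 0) :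
    ‖(n : ℂ_[p])‖ = (p : ℝ)⁻¹ ^ padicValNat p n := by
  obtain ⟨m, hm⟩ := pow_padicValNat_dvd (p := p) (n := n)
  have hpm : ¬ p ∣ m := fun ⟨l, hl⟩ => pow_succ_padicValNat_not_dvd (p := p) h
    ⟨l, by rw [pow_succ, mul_assoc, ← hl]; exact hm⟩
  conv_lhs => rw [hm]
  rw [Nat.cast_mul, Nat.cast_pow, norm_mul, norm_pow, norm_p, norm_natCast_eq_one p hpm, mul_one]

theorem padicCongr_iff {x y γ : ℂ_[p]} (hγ : γ ≠ 0) : PadicCongr p x y γ ↔ ‖x - y‖ ≤ ‖γ‖ := by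
  rw [PadicCongr, norm_div, div_le_one (norm_pos_iff.mpr hγ)]

variable {p}

theorem four_mul_padicValNat_factorial_le (h3 : 3 < p) {k : ℕ} (hk : k ≠ 0) :
    4 * padicValNat p k.factorial + 1 ≤ k := by
  have h := sub_one_mul_padicValNat_factorial_lt_of_ne_zero p hk
  have h5 : 4 ≤ p - 1 := by
    have : p ≠ 4 := fun h => by have := hp.out; rw [h] at this; revert this; decide
    omega
  have := Nat.mul_le_mul_right (padicValNat p k.factorial) h5
  omega

theorem inv_p_pos : 0 < (p : ℝ)⁻¹ := inv_pos.mpr (Nat.cast_pos.mpr hp.out.pos)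
theorem inv_p_lt_one : (p : ℝ)⁻¹ < 1 := inv_lt_one_of_one_lt₀ (by exact_mod_cast hp.out.one_lt)

/-- If `v_p(x) ≥ m` and `m - v_p(k!) ≥ e` then `x / k!` is divisible by `p ^ e`. -/
theorem norm_div_factorial_le {x : ℂ_[p]} {m e k : ℕ} (hx : ‖x‖ ≤ (p : ℝ)⁻¹ ^ m)
    (he : e + padicValNat p k.factorial ≤ m) : ‖x / k.factorial‖ ≤ (p : ℝ)⁻¹ ^ e := by
  rw [norm_div, norm_natCast_eq_pow p k.factorial_ne_zero, div_le_iff₀ (pow_pos inv_p_pos _),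
    ← pow_add]
  exact hx.trans (pow_le_pow_of_le_one inv_p_pos.le inv_p_lt_one.le he)

theorem norm_pow_le_inv_pow {x : ℂ_[p]} (hx : ‖x‖ ≤ (p : ℝ)⁻¹) (k : ℕ) : ‖x ^ k‖ ≤ (p : ℝ)⁻¹ ^ k := by
  rw [norm_pow]; exact pow_le_pow_left₀ (norm_nonneg _) hx k

theorem tendsto_inv_p_pow_div_two : Tendsto (fun k : ℕ => (p : ℝ)⁻¹ ^ (k / 2)) atTop (𝓝 0) :=
  (tendsto_pow_atTop_nhds_zero_of_lt_one inv_p_pos.le inv_p_lt_one).comp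
    (Nat.tendsto_div_const_atTop two_ne_zero)

theorem norm_pow_div_factorial_le (h3 : 3 < p) {x : ℂ_[p]} (hx : ‖x‖ ≤ (p : ℝ)⁻¹) (k : ℕ) :
    ‖x ^ k / k.factorial‖ ≤ (p : ℝ)⁻¹ ^ (k / 2) := by
  refine norm_div_factorial_le (norm_pow_le_inv_pow hx k) ?_
  rcases eq_or_ne k 0 with rfl | hk
  · simp
  · have := four_mul_padicValNat_factorial_le h3 hk
    omega

theorem norm_pow_div_factorial_le_min (h3 : 3 < p) {x : ℂ_[p]} (hx : ‖x‖ ≤ (p : ℝ)⁻¹) (k : ℕ) :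
    ‖x ^ k / k.factorial‖ ≤ (p : ℝ)⁻¹ ^ (min k 3) := by
  refine norm_div_factorial_le (norm_pow_le_inv_pow hx k) ?_
  rcases eq_or_ne k 0 with rfl | hk
  · simp
  · have := four_mul_padicValNat_factorial_le h3 hk
    omega

/-- `p B_n` is `p`-integral (a consequence of the theorem of von Staudt and Clausen). -/
theorem norm_bernoulli_le (n : ℕ) : ‖((bernoulli n : ℚ) : ℂ_[p])‖ ≤ p := by
  have hp1 : (1 : ℝ) ≤ p := by exact_mod_cast hp.out.one_le
  have hq : ∀ q : ℕ, q.Prime → ‖(1 / q : ℂ_[p])‖ ≤ p := fun q hq => by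
    rw [norm_div, norm_one]
    by_cases h : p ∣ q
    · rw [← (Nat.prime_dvd_prime_iff_eq hp.out hq).mp h, norm_p]; simp
    · rw [norm_natCast_eq_one p h]; simpa using hp1
  rcases Nat.even_or_odd n with ⟨k, rfl⟩ | hodd
  · rcases Nat.eq_zero_or_pos k with rfl | hk
    · simpa using hp1
    obtain ⟨T, hT⟩ := Bernoulli.vonStaudt_clausen k
    rw [← two_mul, eq_sub_of_add_eq hT.symm]
    push_cast
    refine norm_sub_le_of_ultrametric ((norm_intCast_le_one p T).trans hp1) ?_
    refine IsUltrametricDist.norm_sum_le_of_forall_le_of_nonneg (by positivity) fun q hq' => ?_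
    exact hq q (by simp only [Finset.mem_filter] at hq'; exact hq'.2.1)
  · rcases eq_or_ne n 1 with rfl | h1
    · rw [bernoulli_one]
      push_cast
      rw [neg_div, norm_neg]
      exact_mod_cast hq 2 Nat.prime_two
    · rw [bernoulli_eq_zero_of_odd hodd (by have := hodd.pos; omega)]
      simp

theorem norm_bernoulli_mul_pow_div_factorial_le (h3 : 3 < p) {x : ℂ_[p]}
    (hx : ‖x‖ ≤ (p : ℝ)⁻¹) (j : ℕ) :
    ‖(bernoulli j : ℂ_[p]) * (x ^ j / j.factorial)‖ ≤ p * (p : ℝ)⁻¹ ^ (j / 2) := by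
  rw [norm_mul]
  exact mul_le_mul (norm_bernoulli_le j) (norm_pow_div_factorial_le h3 hx j) (norm_nonneg _)
    (by positivity)

/-- Up to `j = 2` the Bernoulli number is a `p`-adic unit, `B_3` vanishes, and from `j = 4` on
the denominator `p` of `B_j` is compensated by `p ^ j / j!`. -/
theorem norm_bernoulli_mul_pow_div_factorial_le_min (h3 : 3 < p) {x : ℂ_[p]}
    (hx : ‖x‖ ≤ (p : ℝ)⁻¹) (j : ℕ) :
    ‖(bernoulli j : ℂ_[p]) * (x ^ j / j.factorial)‖ ≤ (p : ℝ)⁻¹ ^ (min j 3) := by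
  have hp0 : (p : ℝ) ≠ 0 := by exact_mod_cast hp.out.ne_zero
  have small : ∀ i, ‖((bernoulli i : ℚ) : ℂ_[p])‖ ≤ 1 →
      ‖(bernoulli i : ℂ_[p]) * (x ^ i / i.factorial)‖ ≤ (p : ℝ)⁻¹ ^ (min i 3) := fun i hi => by
    rw [norm_mul]
    exact (mul_le_of_le_one_left (norm_nonneg _) hi).trans (norm_pow_div_factorial_le_min h3 hx i)
  have hnd : ∀ m : ℕ, m ≠ 0 → m < p → ‖(m : ℂ_[p])‖ = 1 := fun m h0 hm =>
    norm_natCast_eq_one p fun h => absurd (Nat.le_of_dvd (Nat.pos_of_ne_zero h0) h) (by omega)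
  rcases lt_or_ge j 4 with hj | hj
  · interval_cases j
    · exact small 0 (by simp)
    · refine small 1 ?_
      have := hnd 2 (by norm_num) (by omega)
      rw [bernoulli_one]; push_cast at this ⊢
      rw [neg_div, norm_neg, norm_div, this]; simp
    · refine small 2 ?_
      have h2 := hnd 2 (by norm_num) (by omega)
      have h3 := hnd 3 (by norm_num) (by omega)
      rw [bernoulli_two]; push_cast at *
      rw [show (6 : ℂ_[p]) = 2 * 3 by norm_num, norm_inv, norm_mul, h2, h3]; simp
    · rw [bernoulli_eq_zero_of_odd (by decide) (by norm_num)]; simp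
  · have h4 : ‖x ^ j / j.factorial‖ ≤ (p : ℝ)⁻¹ ^ 4 := by
      refine norm_div_factorial_le (norm_pow_le_inv_pow hx j) ?_
      have := four_mul_padicValNat_factorial_le h3 (k := j) (by omega)
      omega
    rw [norm_mul]
    calc _ ≤ (p : ℝ) * (p : ℝ)⁻¹ ^ 4 :=
          mul_le_mul (norm_bernoulli_le _) h4 (norm_nonneg _) (by positivity)
      _ = (p : ℝ)⁻¹ ^ 3 := by field_simp
      _ = _ := by rw [min_eq_right (by omega)]

end Norms

/-! ### Generalized Bernoulli numbers as sums over longer intervals -/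

section GenBernoulli

variable {K : Type*} [Field K]

/-- The homogenized Bernoulli polynomial `Fⁿ B_n(x / F)`. -/
def homBernoulli (n : ℕ) (F x : K) : K :=
  ∑ j ∈ Finset.range (n + 1), (n.choose j : K) * (bernoulli j : K) * F ^ j * x ^ (n - j)

theorem homBernoulli_mul_mul (n : ℕ) (c F x : K) :
    homBernoulli n (c * F) (c * x) = c ^ n * homBernoulli n F x := by
  rw [homBernoulli, homBernoulli, Finset.mul_sum]
  refine Finset.sum_congr rfl fun j hj => ?_
  rw [← pow_mul_pow_sub c (Finset.mem_range_succ_iff.mp hj), mul_pow, mul_pow]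
  ring

variable [CharZero K]

theorem rescale_exp_mul (x y : K) :
    PowerSeries.rescale x (PowerSeries.exp K) * PowerSeries.rescale y (PowerSeries.exp K) =
      PowerSeries.rescale (x + y) (PowerSeries.exp K) :=
  PowerSeries.exp_mul_exp_eq_exp_add x y

theorem rescale_exp_sub_one_ne_zero {c : K} (hc : c ≠ 0) :
    PowerSeries.rescale c (PowerSeries.exp K) - 1 ≠ 0 := fun h => by
  have := congrArg (PowerSeries.coeff 1) h
  simp [PowerSeries.coeff_exp, PowerSeries.coeff_one, hc] at this

theorem pow_mul_aeval_bernoulli (n : ℕ) {F : K} (hF : F ≠ 0) (x : K) :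
    F ^ n * Polynomial.aeval (x / F) (Polynomial.bernoulli n) = homBernoulli n F x := by
  rw [Polynomial.bernoulli_def, map_sum, homBernoulli, Finset.mul_sum]
  rw [← Finset.sum_range_reflect]
  refine Finset.sum_congr rfl fun j hj => ?_
  have hj' := Finset.mem_range_succ_iff.mp hj
  rw [Polynomial.aeval_monomial, show n + 1 - 1 - j = n - j by omega,
    Nat.choose_symm hj', Nat.sub_sub_self hj', ← pow_mul_pow_sub F hj', div_pow]
  simp only [map_mul, eq_ratCast, map_natCast]
  field_simp

/-- The numerator `∑ ψ(a) e^{at}` over a multiple of the conductor is the one over the conductor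
times a geometric sum. -/
theorem sum_Icc_mul_rescale_exp {g : ℕ} (ψ : DirichletCharacter K g) (m : ℕ) :
    (∑ a ∈ Finset.Icc 1 (g * m), PowerSeries.C (ψ (a : ZMod g)) *
        PowerSeries.rescale (a : K) (PowerSeries.exp K)) *
      (PowerSeries.rescale (g : K) (PowerSeries.exp K) - 1) =
    (∑ a ∈ Finset.Icc 1 g, PowerSeries.C (ψ (a : ZMod g)) *
        PowerSeries.rescale (a : K) (PowerSeries.exp K)) *
      (PowerSeries.rescale ((g * m : ℕ) : K) (PowerSeries.exp K) - 1) := by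
  have hI : ∀ (N : ℕ) (h : ℕ → PowerSeries K),
      ∑ a ∈ Finset.Icc 1 N, h a = ∑ a ∈ Finset.range N, h (a + 1) := fun N h => by
    rw [Finset.range_eq_Ico, Finset.sum_Ico_add' h 0 N 1]; rfl
  simp only [hI]
  induction m with
  | zero => simp
  | succ m ih =>
    rw [Nat.mul_succ, Finset.sum_range_add, add_mul, ih]
    have : ∑ a ∈ Finset.range g, PowerSeries.C (ψ ((g * m + a + 1 : ℕ) : ZMod g)) *
        PowerSeries.rescale ((g * m + a + 1 : ℕ) : K) (PowerSeries.exp K) =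
        (∑ a ∈ Finset.range g, PowerSeries.C (ψ ((a + 1 : ℕ) : ZMod g)) *
          PowerSeries.rescale ((a + 1 : ℕ) : K) (PowerSeries.exp K)) *
        PowerSeries.rescale ((g * m : ℕ) : K) (PowerSeries.exp K) := by
      rw [Finset.sum_mul]
      refine Finset.sum_congr rfl fun a _ => ?_
      have h1 : ((g * m + a + 1 : ℕ) : ZMod g) = ((a + 1 : ℕ) : ZMod g) := by simp
      have h2 : ((g * m + a + 1 : ℕ) : K) = ((a + 1 : ℕ) : K) + ((g * m : ℕ) : K) := by
        push_cast; ring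
      rw [mul_assoc, rescale_exp_mul, h1, h2]
    rw [this, Nat.cast_add (g * m) g, ← rescale_exp_mul]
    ring

/-- `F B_{n,ψ} = ∑_{a=1}^F ψ(a) Fⁿ B_n(a / F)` for every multiple `F` of the level of `ψ`. -/
theorem mul_genBernoulli {g : ℕ} [NeZero g] (ψ : DirichletCharacter K g) {F : ℕ} (hF : F ≠ 0)
    (hgF : g ∣ F) (n : ℕ) :
    (F : K) * genBernoulli ψ n =
      ∑ a ∈ Finset.Icc 1 F, ψ (a : ZMod g) * homBernoulli n (F : K) a := by
  obtain ⟨m, hm⟩ := hgF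
  have hFK : (F : K) ≠ 0 := Nat.cast_ne_zero.mpr hF
  set E : K → PowerSeries K := fun c => PowerSeries.rescale c (PowerSeries.exp K) with hE
  set S : ℕ → PowerSeries K := fun N => ∑ a ∈ Finset.Icc 1 N, PowerSeries.C (ψ (a : ZMod g)) * E a
    with hS
  have h1 : genBernoulliSeries ψ * (E g - 1) = PowerSeries.X * S g := by
    rw [genBernoulliSeries_mul, Finset.mul_sum]
    exact Finset.sum_congr rfl fun a _ => by ring
  have h2 : S F * (E g - 1) = S g * (E F - 1) := by
    rw [hm]; exact sum_Icc_mul_rescale_exp ψ m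
  have h3 : genBernoulliSeries ψ * (E F - 1) = PowerSeries.X * S F := by
    apply mul_right_cancel₀ (rescale_exp_sub_one_ne_zero (Nat.cast_ne_zero.mpr (NeZero.ne g)) :
      E (g : K) - 1 ≠ 0)
    linear_combination (E F - 1) * h1 - PowerSeries.X * h2
  -- the series of `ψ(a) Fⁿ B_n(a / F) / n!` satisfies the same equation up to the factor `F`
  have h4 : PowerSeries.C (F : K) * genBernoulliSeries ψ =
      ∑ a ∈ Finset.Icc 1 F, PowerSeries.C (ψ (a : ZMod g)) *
        PowerSeries.rescale (F : K) (PowerSeries.mk fun n =>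
          Polynomial.aeval ((a : K) / F) ((1 / n.factorial : ℚ) • Polynomial.bernoulli n)) := by
    apply mul_right_cancel₀ (rescale_exp_sub_one_ne_zero hFK : E (F : K) - 1 ≠ 0)
    rw [mul_assoc, h3, Finset.sum_mul, hS, Finset.mul_sum, Finset.mul_sum]
    refine Finset.sum_congr rfl fun a _ => ?_
    have := congrArg (PowerSeries.rescale (F : K))
      (Polynomial.bernoulli_generating_function ((a : K) / F))
    rw [map_mul, map_mul, map_sub, map_one, PowerSeries.rescale_X,
      PowerSeries.rescale_rescale, div_mul_cancel₀ _ hFK] at this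
    rw [mul_assoc, this]
    ring
  have h5 := congrArg (PowerSeries.coeff n) h4
  rw [PowerSeries.coeff_C_mul, map_sum] at h5
  rw [genBernoulli, mul_left_comm, h5, Finset.mul_sum]
  refine Finset.sum_congr rfl fun a _ => ?_
  have hn : (n.factorial : K) ≠ 0 := Nat.cast_ne_zero.mpr n.factorial_ne_zero
  rw [PowerSeries.coeff_C_mul, PowerSeries.coeff_rescale, PowerSeries.coeff_mk,
    ← pow_mul_aeval_bernoulli n hFK, map_smul, Rat.smul_def]
  push_cast
  field_simp

theorem sum_Icc_filter_not_dvd {M : Type*} [AddCommGroup M] {q F : ℕ} (hq : q ≠ 0) (hqF : q ∣ F)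
    (h : ℕ → M) : ∑ a ∈ (Finset.Icc 1 F).filter (fun a => ¬ q ∣ a), h a =
      ∑ a ∈ Finset.Icc 1 F, h a - ∑ b ∈ Finset.Icc 1 (F / q), h (q * b) := by
  rw [← Finset.sum_filter_add_sum_filter_not (Finset.Icc 1 F) (fun a => q ∣ a) h]
  obtain ⟨F, rfl⟩ := hqF
  have hq' := Nat.pos_of_ne_zero hq
  have : ∑ a ∈ (Finset.Icc 1 (q * F)).filter (fun a => q ∣ a), h a =
      ∑ b ∈ Finset.Icc 1 (q * F / q), h (q * b) := by
    rw [Nat.mul_div_cancel_left _ hq']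
    refine (Finset.sum_bij (fun b _ => q * b) ?_ ?_ ?_ ?_).symm
    · intro b hb
      simp only [Finset.mem_filter, Finset.mem_Icc] at hb ⊢
      exact ⟨⟨Nat.mul_pos hq' hb.1, Nat.mul_le_mul_left q hb.2⟩, dvd_mul_right _ _⟩
    · intro b _ c _ hbc
      exact Nat.eq_of_mul_eq_mul_left hq' hbc
    · rintro a ha
      simp only [Finset.mem_filter, Finset.mem_Icc] at ha
      obtain ⟨⟨h1, h2⟩, b, rfl⟩ := ha
      exact ⟨b, Finset.mem_Icc.mpr ⟨Nat.pos_of_mul_pos_left h1, Nat.le_of_mul_le_mul_left h2 hq'⟩,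
        rfl⟩
    · exact fun _ _ => rfl
  rw [this]
  abel

/-- Removing the multiples of `q` produces the Euler factor at `q`. -/
theorem sum_filter_mul_homBernoulli {g : ℕ} [NeZero g] (ψ : DirichletCharacter K g) {q F : ℕ}
    (hq : q.Prime) (hF : F ≠ 0) (hgF : g ∣ F) (hqF : q ∣ F) {n : ℕ} (hn : 1 ≤ n) :
    ∑ a ∈ (Finset.Icc 1 F).filter (fun a => ¬ q ∣ a),
        ψ (a : ZMod g) * homBernoulli n (F : K) a =
      F * ((1 - ψ (q : ZMod g) * (q : K) ^ (n - 1)) * genBernoulli ψ n) := by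
  have hqK : (q : K) ≠ 0 := Nat.cast_ne_zero.mpr hq.ne_zero
  rw [sum_Icc_filter_not_dvd hq.ne_zero hqF, ← mul_genBernoulli ψ hF hgF]
  obtain ⟨F, rfl⟩ := hqF
  rw [Nat.mul_div_cancel_left _ hq.pos]
  have h1 : ∑ b ∈ Finset.Icc 1 F, ψ ((q * b : ℕ) : ZMod g) *
      homBernoulli n ((q * F : ℕ) : K) ((q * b : ℕ) : K) = ψ (q : ZMod g) * q ^ n *
        ∑ b ∈ Finset.Icc 1 F, ψ (b : ZMod g) * homBernoulli n (F : K) b := by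
    rw [Finset.mul_sum]
    refine Finset.sum_congr rfl fun b _ => ?_
    push_cast
    rw [map_mul, homBernoulli_mul_mul]
    ring
  rw [h1]
  by_cases h0 : ψ (q : ZMod g) = 0
  · rw [h0]; ring
  · have hcop : Nat.Coprime q g := by
      by_contra h
      exact h0 (ψ.map_nonunit fun hu => h ((ZMod.isUnit_iff_coprime q g).mp hu))
    have hF' : F ≠ 0 := fun h => hF (by simp [h])
    rw [← mul_genBernoulli ψ hF' (hcop.symm.dvd_of_dvd_mul_left hgF)]
    obtain ⟨n, rfl⟩ := Nat.exists_eq_add_of_le' hn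
    rw [Nat.add_sub_cancel]
    push_cast
    ring

end GenBernoulli

/-! ### The twists `χ ω⁻ⁿ` -/

section Twist

variable {R : Type*} [CommRing R]

/-- At integers prime to `p`, the primitive character attached to `χ θ`, with `χ` primitive and `θ`
of level `p`, agrees with the product: the conductor of `χ θ` still contains every prime divisor
of `f` other than `p`. -/
theorem primitiveCharacter_mul_apply {p f : ℕ} (hp : p.Prime) [NeZero f]
    {χ : DirichletCharacter R f} (hχ : χ.IsPrimitive) (θ : DirichletCharacter R p) {a : ℕ}
    (ha : ¬ p ∣ a) :
    (χ.mul θ).primitiveCharacter (a : ZMod _) = χ (a : ZMod f) * θ (a : ZMod p) := by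
  have hF : NeZero (Nat.lcm f p) := ⟨Nat.lcm_ne_zero (NeZero.ne f) hp.ne_zero⟩
  by_cases hcop : Nat.Coprime a (Nat.lcm f p)
  · have hz : IsCoprime (a : ℤ) (Nat.lcm f p : ℕ) := Nat.isCoprime_iff_coprime.mpr hcop
    have h1 := (χ.mul θ).primitiveCharacter_apply_of_isCoprime hz
    have h2 := χ.changeLevel_eq_cast_of_dvd' (Nat.dvd_lcm_left f p) hz
    have h3 := θ.changeLevel_eq_cast_of_dvd' (Nat.dvd_lcm_right f p) hz
    simp only [Int.cast_natCast] at h1 h2 h3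
    rw [h1, DirichletCharacter.mul, MulChar.mul_apply, h2, h3]
  -- both sides vanish: `a` shares with `f` a prime `q ≠ p`, which divides both conductors
  · obtain ⟨q, hq, hqa, hqF⟩ := Nat.Prime.not_coprime_iff_dvd.mp hcop
    have hqp : ¬ q ∣ p := fun h => ha ((Nat.prime_dvd_prime_iff_eq hq hp).mp h ▸ hqa)
    have hqf : q ∣ f := (hq.dvd_mul.mp (hqF.trans (Nat.lcm_dvd_mul f p))).resolve_right hqp
    -- `χ` is the product of `χ θ` and `θ⁻¹`, so `f` divides the lcm of their conductors
    have hqg : q ∣ (χ.mul θ).conductor := by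
      have h1 : f ∣ ((χ.mul θ).conductor).lcm p := by
        have h := DirichletCharacter.conductor_mul_dvd_lcm_conductor (χ.mul θ)
          (DirichletCharacter.changeLevel (Nat.dvd_lcm_right f p) θ)⁻¹
        rw [DirichletCharacter.conductor_inv, DirichletCharacter.conductor_changeLevel,
          DirichletCharacter.mul, mul_inv_cancel_right,
          DirichletCharacter.conductor_changeLevel, (DirichletCharacter.isPrimitive_def χ).mp hχ]
          at h
        exact h.trans (Nat.lcm_dvd (Nat.dvd_lcm_left _ _)
          (θ.conductor_dvd_level.trans (Nat.dvd_lcm_right _ _)))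
      exact (hq.dvd_mul.mp ((hqf.trans h1).trans (Nat.lcm_dvd_mul _ _))).resolve_right hqp
    have hnu : ∀ N : ℕ, q ∣ N → ¬ IsUnit (a : ZMod N) := fun N hN hu =>
      Nat.not_coprime_of_dvd_of_dvd hq.one_lt hqa hN ((ZMod.isUnit_iff_coprime a N).mp hu)
    rw [MulChar.map_nonunit _ (hnu _ hqg), χ.map_nonunit (hnu _ hqf), zero_mul]

end Twist

/-! ### The principal units `⟨a⟩ = a / ω(a)` -/

section PrincipalUnit

variable (p : ℕ) [hp : Fact p.Prime]

/-- The deviation `⟨a⟩ - 1 = a / ω(a) - 1` of the principal unit `⟨a⟩` from `1`. -/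
def unitDev (a : ℕ) : ℂ_[p] := a / teichmullerChar p (a : ZMod p) - 1

variable {p} {a : ℕ} (ha : ¬ p ∣ a)
include ha

theorem natCast_zmod_ne_zero : (a : ZMod p) ≠ 0 := fun h => ha ((ZMod.natCast_eq_zero_iff a p).mp h)

theorem teichmullerChar_pow_sub_one : teichmullerChar p (a : ZMod p) ^ (p - 1) = 1 := by
  change toCp p (teichmullerRep p a) ^ (p - 1) = 1
  rw [← toCp_pow, teichmullerRep_pow p _ (natCast_zmod_ne_zero ha), toCp_one]

theorem norm_teichmullerChar : ‖teichmullerChar p (a : ZMod p)‖ = 1 := by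
  have h := congrArg norm (teichmullerChar_pow_sub_one ha)
  rw [norm_pow, norm_one] at h
  have := hp.out.two_le
  exact (pow_eq_one_iff_of_nonneg (norm_nonneg _) (by omega)).mp h

theorem teichmullerChar_ne_zero : teichmullerChar p (a : ZMod p) ≠ 0 := by
  rw [← norm_pos_iff, norm_teichmullerChar ha]; exact one_pos

theorem norm_unitDev_le : ‖unitDev p a‖ ≤ (p : ℝ)⁻¹ := by
  have h0 := teichmullerChar_ne_zero ha
  have h1 : unitDev p a = (a - teichmullerChar p (a : ZMod p)) / teichmullerChar p (a : ZMod p) := by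
    rw [unitDev]; field_simp
  rw [h1, norm_div, norm_teichmullerChar ha, div_one]
  change ‖(a : ℂ_[p]) - toCp p (teichmullerRep p a)‖ ≤ _
  rw [← toCp_natCast, ← toCp_sub, norm_toCp]
  have h2 : (a : ℤ_[p]) - teichmullerRep p a ∈ IsLocalRing.maximalIdeal ℤ_[p] := by
    rw [← PadicInt.ker_toZMod, RingHom.mem_ker, map_sub, toZMod_teichmullerRep, map_natCast,
      sub_self]
  rw [PadicInt.maximalIdeal_eq_span_p, Ideal.mem_span_singleton] at h2
  obtain ⟨z, hz⟩ := h2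
  rw [hz, norm_mul, PadicInt.norm_p]
  exact mul_le_of_le_one_right (by positivity) (PadicInt.norm_le_one z)

theorem natCast_eq_teichmullerChar_mul :
    (a : ℂ_[p]) = teichmullerChar p (a : ZMod p) * (1 + unitDev p a) := by
  have h0 := teichmullerChar_ne_zero ha
  rw [unitDev]; field_simp; ring

theorem p_mul_fermatQuot : (p : ℂ_[p]) * fermatQuot p a = (1 + unitDev p a) ^ (p - 1) - 1 := by
  have hp0 : (p : ℂ_[p]) ≠ 0 := Nat.cast_ne_zero.mpr hp.out.ne_zero
  rw [fermatQuot, mul_div_cancel₀ _ hp0]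
  nth_rewrite 1 [natCast_eq_teichmullerChar_mul ha]
  rw [mul_pow, teichmullerChar_pow_sub_one ha, one_mul]

end PrincipalUnit

section Expansion

variable {p : ℕ} [hp : Fact p.Prime]

theorem exists_one_add_pow_eq {y : ℂ_[p]} (hy : ‖y‖ ≤ 1) (N : ℕ) :
    ∃ w : ℂ_[p], ‖w‖ ≤ 1 ∧ (1 + y) ^ N = 1 + N * y + N.choose 2 * y ^ 2 + w * y ^ 3 := by
  induction N with
  | zero => exact ⟨0, by simp, by simp⟩
  | succ N ih =>
    obtain ⟨w, hw, h⟩ := ih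
    refine ⟨w * (1 + y) + N.choose 2, norm_add_le_of_ultrametric ?_ (norm_natCast_le_one p _), ?_⟩
    · rw [norm_mul]
      exact mul_le_one₀ hw (norm_nonneg _) (norm_add_le_of_ultrametric (by simp) hy)
    · rw [pow_succ, h, Nat.choose_succ_succ' N 1, Nat.choose_one_right]
      push_cast
      ring

theorem norm_pred_prime_eq_one : ‖(p : ℂ_[p]) - 1‖ = 1 := by
  have h := norm_natCast_eq_one p (n := p - 1) fun h => by
    have := hp.out.two_le
    exact absurd (Nat.le_of_dvd (by omega) h) (by omega)
  rwa [Nat.cast_pred hp.out.pos] at h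

theorem norm_two_eq_one (h3 : 3 < p) : ‖(2 : ℂ_[p])‖ = 1 := by
  exact_mod_cast norm_natCast_eq_one p (n := 2) fun h => absurd (Nat.le_of_dvd two_pos h) (by omega)

/-- The expansions `z = (1 + y)^{p-1} - 1 = (p - 1) y + u y²` and `z² = (p - 1)² y² + v y³`; the
first one is also known to the next order. -/
theorem exists_unitDev_expansion {y : ℂ_[p]} (hy : ‖y‖ ≤ 1) :
    ∃ u v w : ℂ_[p], ‖u‖ ≤ 1 ∧ ‖v‖ ≤ 1 ∧ ‖w‖ ≤ 1 ∧
      (1 + y) ^ (p - 1) - 1 = (p - 1) * y + u * y ^ 2 ∧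
      (1 + y) ^ (p - 1) - 1 = (p - 1) * y + (p - 1) * (p - 2) / 2 * y ^ 2 + w * y ^ 3 ∧
      ((1 + y) ^ (p - 1) - 1) ^ 2 = (p - 1) ^ 2 * y ^ 2 + v * y ^ 3 := by
  obtain ⟨w, hw, h⟩ := exists_one_add_pow_eq hy (p - 1)
  have hC : (((p - 1).choose 2 : ℕ) : ℂ_[p]) = (p - 1) * (p - 2) / 2 := by
    rw [Nat.cast_choose_two, Nat.cast_pred hp.out.pos]; ring
  have hM : ((p - 1 : ℕ) : ℂ_[p]) = p - 1 := Nat.cast_pred hp.out.pos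
  have hC1 := norm_natCast_le_one p ((p - 1).choose 2)
  rw [hC] at h hC1
  rw [hM] at h
  have hmul : ∀ {x x' : ℂ_[p]}, ‖x‖ ≤ 1 → ‖x'‖ ≤ 1 → ‖x * x'‖ ≤ 1 := fun hx hx' => by
    rw [norm_mul]; exact mul_le_one₀ hx (norm_nonneg _) hx'
  have h2 : ‖(2 : ℂ_[p])‖ ≤ 1 := by exact_mod_cast norm_natCast_le_one p 2
  set u : ℂ_[p] := (p - 1) * (p - 2) / 2 + w * y with hu
  have hu1 : ‖u‖ ≤ 1 := norm_add_le_of_ultrametric hC1 (hmul hw hy)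
  refine ⟨u, 2 * (p - 1) * u + u * u * y, w, hu1, ?_, hw, ?_, ?_, ?_⟩
  · exact norm_add_le_of_ultrametric (hmul (hmul h2 norm_pred_prime_eq_one.le) hu1)
      (hmul (hmul hu1 hu1) hy)
  · rw [h]; ring
  · rw [h]; ring
  · rw [h, hu]; ring

variable (h3 : 3 < p) {a : ℕ} (ha : ¬ p ∣ a)
include h3 ha

/-- Both sides are `log ⟨a⟩` modulo `p ^ 3`. -/
theorem norm_fermatQuot_log_sub_le :
    ‖1 / ((p : ℂ_[p]) - 1) * (p * fermatQuot p a - p ^ 2 * fermatQuot p a ^ 2 / 2) -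
      (unitDev p a - unitDev p a ^ 2 / 2)‖ ≤ (p : ℝ)⁻¹ ^ 3 := by
  have hy := norm_unitDev_le ha
  obtain ⟨u, v, w, hu, hv, hw, h1, h2, h3'⟩ :=
    exists_unitDev_expansion (hy.trans inv_p_lt_one.le)
  have hM := norm_pred_prime_eq_one (p := p)
  have hM0 : (p : ℂ_[p]) - 1 ≠ 0 := norm_pos_iff.mp (by rw [hM]; exact one_pos)
  rw [← mul_pow, p_mul_fermatQuot ha, h3', h2]
  have : 1 / ((p : ℂ_[p]) - 1) * ((p - 1) * unitDev p a + (p - 1) * (p - 2) / 2 * unitDev p a ^ 2 +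
      w * unitDev p a ^ 3 - ((p - 1) ^ 2 * unitDev p a ^ 2 + v * unitDev p a ^ 3) / 2) -
      (unitDev p a - unitDev p a ^ 2 / 2) =
      ((w - v / 2) / (p - 1)) * unitDev p a ^ 3 := by
    field_simp; ring
  rw [this, norm_mul, norm_div, hM, div_one]
  refine (mul_le_of_le_one_left (norm_nonneg _) ?_).trans (norm_pow_le_inv_pow hy 3)
  refine norm_sub_le_of_ultrametric hw ?_
  rwa [norm_div, norm_two_eq_one h3, div_one]

theorem norm_fermatQuot_sq_sub_le :
    ‖(p : ℂ_[p]) ^ 2 * fermatQuot p a ^ 2 / (2 * ((p : ℂ_[p]) - 1) ^ 2) - unitDev p a ^ 2 / 2‖ ≤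
      (p : ℝ)⁻¹ ^ 3 := by
  have hy := norm_unitDev_le ha
  obtain ⟨u, v, w, hu, hv, hw, h1, h2, h3'⟩ :=
    exists_unitDev_expansion (hy.trans inv_p_lt_one.le)
  have hM := norm_pred_prime_eq_one (p := p)
  have hM0 : (p : ℂ_[p]) - 1 ≠ 0 := norm_pos_iff.mp (by rw [hM]; exact one_pos)
  rw [← mul_pow, p_mul_fermatQuot ha, h3']
  have : ((p - 1) ^ 2 * unitDev p a ^ 2 + v * unitDev p a ^ 3) / (2 * ((p : ℂ_[p]) - 1) ^ 2) -
      unitDev p a ^ 2 / 2 = v / (2 * (p - 1) ^ 2) * unitDev p a ^ 3 := by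
    field_simp; ring
  rw [this, norm_mul, norm_div, norm_mul, norm_pow, hM, norm_two_eq_one h3]
  norm_num
  exact (mul_le_of_le_one_left (by positivity) hv).trans
    (by simpa using norm_pow_le_inv_pow hy 3)

theorem norm_fermatQuot_mul_sub_le {t : ℂ_[p]} (ht : ‖t‖ ≤ (p : ℝ)⁻¹) :
    ‖p * fermatQuot p a / (2 * ((p : ℂ_[p]) - 1)) * t - unitDev p a / 2 * t‖ ≤
      (p : ℝ)⁻¹ ^ 3 := by
  have hy := norm_unitDev_le ha
  obtain ⟨u, v, w, hu, hv, hw, h1, h2, h3'⟩ :=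
    exists_unitDev_expansion (hy.trans inv_p_lt_one.le)
  have hM := norm_pred_prime_eq_one (p := p)
  have hM0 : (p : ℂ_[p]) - 1 ≠ 0 := norm_pos_iff.mp (by rw [hM]; exact one_pos)
  rw [p_mul_fermatQuot ha, h1]
  have : ((p - 1) * unitDev p a + u * unitDev p a ^ 2) / (2 * ((p : ℂ_[p]) - 1)) * t -
      unitDev p a / 2 * t = u / (2 * (p - 1)) * (unitDev p a ^ 2 * t) := by
    field_simp; ring
  rw [this, norm_mul, norm_div, norm_mul, hM, norm_two_eq_one h3, mul_one, div_one, norm_mul,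
    pow_succ (p : ℝ)⁻¹ 2]
  refine (mul_le_of_le_one_left (mul_nonneg (norm_nonneg _) (norm_nonneg _)) hu).trans ?_
  exact mul_le_mul (norm_pow_le_inv_pow hy 2) ht (norm_nonneg _) (pow_pos inv_p_pos _).le

end Expansion

/-! ### The normalized character sums -/

section RestrictedAverage

variable {p : ℕ} [hp : Fact p.Prime] {f : ℕ} (χ : DirichletCharacter ℂ_[p] f)

theorem restrictedAverage_sub (h₁ h₂ : ℕ → ℂ_[p]) :
    restrictedAverage p χ h₁ - restrictedAverage p χ h₂ =
      restrictedAverage p χ fun a => h₁ a - h₂ a := by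
  simp only [restrictedAverage, mul_sub, Finset.sum_sub_distrib]

theorem restrictedAverage_add (h₁ h₂ : ℕ → ℂ_[p]) :
    restrictedAverage p χ h₁ + restrictedAverage p χ h₂ =
      restrictedAverage p χ fun a => h₁ a + h₂ a := by
  simp only [restrictedAverage, mul_add, Finset.sum_add_distrib]

theorem restrictedAverage_mul (h : ℕ → ℂ_[p]) (z : ℂ_[p]) :
    restrictedAverage p χ h * z = restrictedAverage p χ fun a => h a * z := by
  simp only [restrictedAverage, ← mul_assoc]
  rw [mul_assoc, Finset.sum_mul]

theorem restrictedAverage_sum {ι : Type*} (s : Finset ι) (h : ι → ℕ → ℂ_[p]) :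
    ∑ i ∈ s, restrictedAverage p χ (h i) = restrictedAverage p χ fun a => ∑ i ∈ s, h i a := by
  simp only [restrictedAverage, Finset.mul_sum]
  exact Finset.sum_comm

theorem restrictedAverage_congr {h₁ h₂ : ℕ → ℂ_[p]} (h : ∀ a, ¬ p ∣ a → h₁ a = h₂ a) :
    restrictedAverage p χ h₁ = restrictedAverage p χ h₂ := by
  rw [restrictedAverage, restrictedAverage]
  congr 1
  exact Finset.sum_congr rfl fun a ha => by rw [h a (Finset.mem_filter.mp ha).2]

theorem not_sq_dvd_lcm (hf : ¬ p ^ 2 ∣ f) : ¬ p ^ 2 ∣ Nat.lcm f p := fun h => by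
  by_cases hpf : p ∣ f
  · exact hf (by rwa [Nat.lcm_eq_left hpf] at h)
  · have hcop : Nat.Coprime (p ^ 2) f := ((Nat.Prime.coprime_iff_not_dvd hp.out).mpr hpf).pow_left 2
    have := Nat.le_of_dvd hp.out.pos (hcop.dvd_of_dvd_mul_left (h.trans (Nat.lcm_dvd_mul f p)))
    nlinarith [hp.out.two_le]

theorem norm_lcm (hf : ¬ p ^ 2 ∣ f) : ‖(Nat.lcm f p : ℂ_[p])‖ = (p : ℝ)⁻¹ :=
  norm_natCast_of_dvd p (Nat.dvd_lcm_right f p) (not_sq_dvd_lcm hf)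

theorem norm_lcm_div (hf : ¬ p ^ 2 ∣ f) {a : ℕ} (ha : ¬ p ∣ a) :
    ‖(Nat.lcm f p : ℂ_[p]) / a‖ ≤ (p : ℝ)⁻¹ := by
  rw [norm_div, norm_lcm hf, norm_natCast_eq_one p ha, div_one]

/-- The factor `1 / F` costs exactly one power of `p`, as `p ^ 2 ∤ F`. -/
theorem norm_restrictedAverage_le (hf : ¬ p ^ 2 ∣ f) {h : ℕ → ℂ_[p]} {r : ℝ} (hr : 0 ≤ r)
    (hh : ∀ a, ¬ p ∣ a → ‖h a‖ ≤ r) : ‖restrictedAverage p χ h‖ ≤ p * r := by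
  rw [restrictedAverage, norm_mul, norm_neg, norm_div, norm_one, norm_lcm hf, one_div, inv_inv]
  refine mul_le_mul_of_nonneg_left ?_ (by positivity)
  refine IsUltrametricDist.norm_sum_le_of_forall_le_of_nonneg hr fun a ha => ?_
  rw [norm_mul]
  exact (mul_le_of_le_one_left (norm_nonneg _) (χ.norm_le_one _)).trans
    (hh a (Finset.mem_filter.mp ha).2)

theorem p_mul_inv_pow_succ (n : ℕ) : (p : ℝ) * (p : ℝ)⁻¹ ^ (n + 1) = (p : ℝ)⁻¹ ^ n := by
  have : (p : ℝ) ≠ 0 := by exact_mod_cast hp.out.ne_zero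
  rw [pow_succ]; field_simp

theorem norm_restrictedAverage_sub_le (hf : ¬ p ^ 2 ∣ f) {h₁ h₂ : ℕ → ℂ_[p]}
    (hh : ∀ a, ¬ p ∣ a → ‖h₁ a - h₂ a‖ ≤ (p : ℝ)⁻¹ ^ 3) :
    ‖restrictedAverage p χ h₁ - restrictedAverage p χ h₂‖ ≤ (p : ℝ)⁻¹ ^ 2 := by
  rw [restrictedAverage_sub, ← p_mul_inv_pow_succ]
  exact norm_restrictedAverage_le χ hf (pow_pos inv_p_pos _).le hh

theorem sum_Icc_dirichletCharacter_eq_zero [NeZero f] (hχ : χ ≠ 1) {N : ℕ} (hN : N ≠ 0)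
    (hfN : f ∣ N) : ∑ a ∈ Finset.Icc 1 N, χ (a : ZMod f) = 0 := by
  have h0 : ∀ {N : ℕ}, N ≠ 0 → f ∣ N →
      (N : ℂ_[p]) * genBernoulli χ 0 = ∑ a ∈ Finset.Icc 1 N, χ (a : ZMod f) := fun hN h => by
    rw [mul_genBernoulli χ hN h]; simp [homBernoulli]
  have hf : ∑ a ∈ Finset.Icc 1 f, χ (a : ZMod f) = 0 := by
    rw [← MulChar.sum_eq_zero_of_ne_one hχ]
    refine Finset.sum_bij (fun a _ => (a : ZMod f)) (fun _ _ => Finset.mem_univ _) ?_ ?_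
      fun _ _ => rfl
    · intro a ha b hb hab
      rw [Finset.mem_Icc] at ha hb
      rw [ZMod.natCast_eq_natCast_iff] at hab
      have h1 : a - 1 ≡ b - 1 [MOD f] := by
        apply Nat.ModEq.add_right_cancel' 1
        rwa [Nat.sub_add_cancel ha.1, Nat.sub_add_cancel hb.1]
      have := h1.eq_of_lt_of_lt (by omega) (by omega)
      omega
    · intro x _
      refine ⟨(x - 1).val + 1, Finset.mem_Icc.mpr ⟨by omega, (x - 1).val_lt⟩, ?_⟩
      push_cast
      rw [ZMod.natCast_zmod_val]; ring
  rw [← h0 (NeZero.ne f) dvd_rfl, mul_eq_zero] at hf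
  rw [← h0 hN hfN, hf.resolve_left (Nat.cast_ne_zero.mpr (NeZero.ne f)), mul_zero]

theorem restrictedAverage_one_eq_zero [NeZero f] (hχ : χ ≠ 1) :
    restrictedAverage p χ (fun _ => 1) = 0 := by
  have hF : Nat.lcm f p ≠ 0 := Nat.lcm_ne_zero (NeZero.ne f) hp.out.ne_zero
  simp only [restrictedAverage, mul_one]
  rw [sum_Icc_filter_not_dvd hp.out.ne_zero (Nat.dvd_lcm_right f p),
    sum_Icc_dirichletCharacter_eq_zero χ hχ hF (Nat.dvd_lcm_left f p)]
  simp only [Nat.cast_mul, map_mul, ← Finset.mul_sum]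
  by_cases hpf : p ∣ f
  · rw [χ.map_nonunit (a := (p : ZMod f)) fun hu =>
      Nat.not_coprime_of_dvd_of_dvd hp.out.one_lt dvd_rfl hpf ((ZMod.isUnit_iff_coprime p f).mp hu)]
    simp
  · have hcop : Nat.Coprime f p := ((Nat.Prime.coprime_iff_not_dvd hp.out).mpr hpf).symm
    rw [hcop.lcm_eq_mul, Nat.mul_div_cancel _ hp.out.pos,
      sum_Icc_dirichletCharacter_eq_zero χ hχ (NeZero.ne f) dvd_rfl]
    simp

omit χ in
theorem restrictedAverage_one_one :
    restrictedAverage p (1 : DirichletCharacter ℂ_[p] 1) (fun _ => 1) = (p : ℂ_[p])⁻¹ - 1 := by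
  have hp0 : (p : ℂ_[p]) ≠ 0 := Nat.cast_ne_zero.mpr hp.out.ne_zero
  have h1 : ∀ x : ZMod 1, (1 : DirichletCharacter ℂ_[p] 1) x = 1 := fun x =>
    MulChar.one_apply (isUnit_of_subsingleton x)
  simp only [restrictedAverage, mul_one, h1]
  rw [sum_Icc_filter_not_dvd hp.out.ne_zero (Nat.dvd_lcm_right 1 p), Nat.lcm_one_left,
    Nat.div_self hp.out.pos]
  simp
  field_simp
  ring

end RestrictedAverage

/-! ### The numerator of `L_p(1 - s, χ)` as a power series in `s` -/

section Numerator

variable {p : ℕ} [hp : Fact p.Prime] {f : ℕ} (χ : DirichletCharacter ℂ_[p] f)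

/-- The coefficient of `C(s, k) C(s, j) k! j!` in
`-(1/F) ∑ χ(a) ⟨a⟩^s ∑_j C(s, j) B_j (F / a)^j`, with `⟨a⟩^s` expanded as
`∑_k C(s, k) (⟨a⟩ - 1)^k`. -/
def mahlerCoeff (k j : ℕ) : ℂ_[p] :=
  restrictedAverage p χ fun a => unitDev p a ^ k / k.factorial *
    (bernoulli j * (((Nat.lcm f p : ℂ_[p]) / a) ^ j / j.factorial))

/-- The `(k, j)`-th term of the numerator `s L_p(1 - s, χ)`, as a polynomial in `s`. -/
def numeratorPoly (x : ℕ × ℕ) : Polynomial ℂ_[p] :=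
  Polynomial.C (mahlerCoeff χ x.1 x.2) * (descPochhammer ℂ_[p] x.1 * descPochhammer ℂ_[p] x.2)

/-- The coefficient of `s ^ i` in the numerator `s L_p(1 - s, χ)`. -/
def numeratorCoeff (i : ℕ) : ℂ_[p] := ∑' x, (numeratorPoly χ x).coeff i

variable (h3 : 3 < p) (hf : ¬ p ^ 2 ∣ f)

theorem norm_descPochhammer_mul_coeff_le (k j i : ℕ) :
    ‖(descPochhammer ℂ_[p] k * descPochhammer ℂ_[p] j).coeff i‖ ≤ 1 := by
  rw [← descPochhammer_map (Int.castRingHom ℂ_[p]), ← descPochhammer_map (Int.castRingHom ℂ_[p]),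
    ← Polynomial.map_mul, Polynomial.coeff_map]
  exact norm_intCast_le_one p _

theorem norm_numeratorPoly_coeff_le (x : ℕ × ℕ) (i : ℕ) :
    ‖(numeratorPoly χ x).coeff i‖ ≤ ‖mahlerCoeff χ x.1 x.2‖ := by
  rw [numeratorPoly, Polynomial.coeff_C_mul, norm_mul]
  exact mul_le_of_le_one_right (norm_nonneg _) (norm_descPochhammer_mul_coeff_le _ _ _)

include h3 hf

theorem norm_mahlerCoeff_le (k j : ℕ) :
    ‖mahlerCoeff χ k j‖ ≤ p * ((p : ℝ)⁻¹ ^ (k / 2) * (p * (p : ℝ)⁻¹ ^ (j / 2))) :=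
  norm_restrictedAverage_le χ hf (by positivity) fun a ha => by
    rw [norm_mul]
    exact mul_le_mul (norm_pow_div_factorial_le h3 (norm_unitDev_le ha) k)
      (norm_bernoulli_mul_pow_div_factorial_le h3 (norm_lcm_div hf ha) j) (norm_nonneg _)
      (pow_pos inv_p_pos _).le

theorem norm_mahlerCoeff_le_min (k j : ℕ) :
    ‖mahlerCoeff χ k j‖ ≤ p * (p : ℝ)⁻¹ ^ (min k 3 + min j 3) :=
  norm_restrictedAverage_le χ hf (by positivity) fun a ha => by
    rw [norm_mul, pow_add]
    exact mul_le_mul (norm_pow_div_factorial_le_min h3 (norm_unitDev_le ha) k)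
      (norm_bernoulli_mul_pow_div_factorial_le_min h3 (norm_lcm_div hf ha) j) (norm_nonneg _)
      (pow_pos inv_p_pos _).le

theorem norm_mahlerCoeff_le_pow {k j m : ℕ} (h : m + 1 ≤ min k 3 + min j 3) :
    ‖mahlerCoeff χ k j‖ ≤ (p : ℝ)⁻¹ ^ m := by
  rw [← p_mul_inv_pow_succ]
  exact (norm_mahlerCoeff_le_min χ h3 hf k j).trans (mul_le_mul_of_nonneg_left
    (pow_le_pow_of_le_one inv_p_pos.le inv_p_lt_one.le h) (by positivity))

theorem tendsto_norm_mahlerCoeff :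
    Tendsto (fun x : ℕ × ℕ => ‖mahlerCoeff χ x.1 x.2‖) cofinite (𝓝 0) := by
  have h1 : Tendsto (fun k : ℕ => (p : ℝ)⁻¹ ^ (k / 2)) cofinite (𝓝 0) := by
    rw [Nat.cofinite_eq_atTop]; exact tendsto_inv_p_pow_div_two
  have h2 := (h1.const_mul (p : ℝ))
  rw [mul_zero] at h2
  have h := (tendsto_mul_cofinite_nhds_zero h1 h2).const_mul (p : ℝ)
  rw [mul_zero] at h
  exact squeeze_zero (fun _ => norm_nonneg _) (fun x => norm_mahlerCoeff_le χ h3 hf x.1 x.2) h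

theorem hasSum_numeratorCoeff {s : ℂ_[p]} (hs : ‖s‖ ≤ 1) :
    HasSum (fun i => numeratorCoeff χ i * s ^ i) (∑' x, (numeratorPoly χ x).eval s) :=
  hasSum_tsum_coeff_mul_pow (tendsto_norm_mahlerCoeff χ h3 hf)
    (norm_numeratorPoly_coeff_le χ) hs

omit h3 hf in
/-- At a natural number `n` the double series is finite and sums to `⟨a⟩ⁿ Fⁿ B_n(a / F) / aⁿ`
inside the average. -/
theorem tsum_numeratorPoly_eval_natCast (n : ℕ) :
    ∑' x, (numeratorPoly χ x).eval (n : ℂ_[p]) = restrictedAverage p χ fun a =>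
      (teichmullerChar p (a : ZMod p))⁻¹ ^ n * homBernoulli n (Nat.lcm f p : ℂ_[p]) a := by
  rw [tsum_eq_sum (s := Finset.range (n + 1) ×ˢ Finset.range (n + 1))]
  · simp only [numeratorPoly, Polynomial.eval_mul, Polynomial.eval_C,
      descPochhammer_eval_eq_descFactorial, mahlerCoeff, restrictedAverage_mul,
      restrictedAverage_sum]
    refine restrictedAverage_congr χ fun a ha => ?_
    have hω := teichmullerChar_ne_zero ha
    have ha0 : (a : ℂ_[p]) ≠ 0 := Nat.cast_ne_zero.mpr fun h => ha (h ▸ dvd_zero p)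
    have h1 : (teichmullerChar p (a : ZMod p))⁻¹ ^ n = (unitDev p a + 1) ^ n / a ^ n := by
      rw [eq_div_iff (pow_ne_zero n ha0), ← mul_pow]
      congr 1
      rw [inv_mul_eq_iff_eq_mul₀ hω, add_comm, ← natCast_eq_teichmullerChar_mul ha]
    have hd : ∀ i : ℕ, (n.descFactorial i : ℂ_[p]) = i.factorial * n.choose i := fun i => by
      rw [Nat.descFactorial_eq_factorial_mul_choose]; push_cast; ring
    have hfac : ∀ i : ℕ, (i.factorial : ℂ_[p]) ≠ 0 := fun i =>
      Nat.cast_ne_zero.mpr i.factorial_ne_zero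
    rw [h1, add_pow, homBernoulli, div_mul_eq_mul_div, Finset.sum_mul_sum, Finset.sum_product,
      Finset.sum_div]
    refine Finset.sum_congr rfl fun k _ => ?_
    rw [Finset.sum_div]
    refine Finset.sum_congr rfl fun j hj => ?_
    rw [hd, hd, ← pow_mul_pow_sub (a : ℂ_[p]) (Finset.mem_range_succ_iff.mp hj), one_pow, div_pow]
    have := hfac k
    have := hfac j
    field_simp
  · rintro ⟨k, j⟩ hx
    simp only [numeratorPoly, Polynomial.eval_mul, Polynomial.eval_C,
      descPochhammer_eval_eq_descFactorial]
    simp only [Finset.mem_product, Finset.mem_range, not_and_or, not_lt] at hx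
    rcases hx with hx | hx
    · rw [Nat.descFactorial_of_lt (by omega : n < k)]; simp
    · rw [Nat.descFactorial_of_lt (by omega : n < j)]; simp

omit h3 hf in
/-- The interpolation property, multiplied by `n`. -/
theorem tsum_numeratorPoly_eval_eq_genBernoulli [NeZero f] (hχ : χ.IsPrimitive) {n : ℕ}
    (hn : 1 ≤ n) :
    ∑' x, (numeratorPoly χ x).eval (n : ℂ_[p]) =
      -((1 - teichmullerTwist p χ n (p : ZMod _) * (p : ℂ_[p]) ^ (n - 1)) *
        genBernoulli (teichmullerTwist p χ n) n) := by
  have hF : Nat.lcm f p ≠ 0 := Nat.lcm_ne_zero (NeZero.ne f) hp.out.ne_zero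
  have : NeZero (Nat.lcm f p) := ⟨hF⟩
  have hg : NeZero (χ.mul ((teichmullerChar p)⁻¹ ^ n)).conductor :=
    ⟨DirichletCharacter.conductor_ne_zero _⟩
  rw [tsum_numeratorPoly_eval_natCast, restrictedAverage]
  have h1 : ∀ a ∈ (Finset.Icc 1 (Nat.lcm f p)).filter (fun a => ¬ p ∣ a),
      χ (a : ZMod f) * ((teichmullerChar p (a : ZMod p))⁻¹ ^ n *
        homBernoulli n (Nat.lcm f p : ℂ_[p]) a) =
      teichmullerTwist p χ n (a : ZMod _) * homBernoulli n (Nat.lcm f p : ℂ_[p]) a := fun a ha => by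
    have hpa := (Finset.mem_filter.mp ha).2
    rw [teichmullerTwist, primitiveCharacter_mul_apply hp.out hχ _ hpa,
      MulChar.pow_apply' _ (by omega), MulChar.inv_apply_eq_inv', mul_assoc]
  rw [Finset.sum_congr rfl h1, sum_filter_mul_homBernoulli (teichmullerTwist p χ n) hp.out hF
    (DirichletCharacter.conductor_dvd_level _) (Nat.dvd_lcm_right f p) hn]
  have hFK : (Nat.lcm f p : ℂ_[p]) ≠ 0 := Nat.cast_ne_zero.mpr hF
  field_simp

omit h3 hf in
theorem numeratorCoeff_zero : numeratorCoeff χ 0 = restrictedAverage p χ fun _ => 1 := by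
  rw [numeratorCoeff, tsum_eq_single (0, 0)]
  · simp [numeratorPoly, mahlerCoeff]
  · rintro ⟨k, j⟩ hx
    have hx' : k ≠ 0 ∨ j ≠ 0 := by
      by_contra h
      push Not at h
      exact hx (by rw [h.1, h.2])
    rw [numeratorPoly, Polynomial.coeff_C_mul, Polynomial.mul_coeff_zero,
      Polynomial.coeff_zero_eq_eval_zero, Polynomial.coeff_zero_eq_eval_zero]
    rcases hx' with h | h
    · simp [descPochhammer_ne_zero_eval_zero ℂ_[p] h]
    · simp [descPochhammer_ne_zero_eval_zero ℂ_[p] h]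

/-- Modulo `p ^ 2` only the terms with `k + j ≤ 2` contribute. -/
theorem norm_numeratorCoeff_sub_le (i : ℕ) :
    ‖numeratorCoeff χ i - ∑ x ∈ {(0, 0), (1, 0), (2, 0), (0, 1), (0, 2), (1, 1)},
      (numeratorPoly χ x).coeff i‖ ≤ (p : ℝ)⁻¹ ^ 2 := by
  set S : Finset (ℕ × ℕ) := {(0, 0), (1, 0), (2, 0), (0, 1), (0, 2), (1, 1)} with hS
  have hsum : Summable fun x => (numeratorPoly χ x).coeff i :=
    NonarchimedeanAddGroup.summable_of_tendsto_cofinite_zero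
      (squeeze_zero_norm (fun x => norm_numeratorPoly_coeff_le χ x i)
        (tendsto_norm_mahlerCoeff χ h3 hf))
  rw [numeratorCoeff, ← hsum.sum_add_tsum_compl (s := S), add_sub_cancel_left]
  refine IsUltrametricDist.norm_tsum_le_of_forall_le_of_nonneg (pow_pos inv_p_pos _).le ?_
  rintro ⟨⟨k, j⟩, hx⟩
  refine (norm_numeratorPoly_coeff_le χ _ i).trans (norm_mahlerCoeff_le_pow χ h3 hf ?_)
  simp only [hS, Finset.coe_insert, Finset.coe_singleton, Set.mem_compl_iff, Set.mem_insert_iff,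
    Set.mem_singleton_iff, Prod.mk.injEq] at hx
  dsimp only
  omega

omit h3 hf in
theorem descPochhammer_two : descPochhammer ℂ_[p] 2 = Polynomial.X ^ 2 - Polynomial.X := by
  rw [descPochhammer_succ_right, descPochhammer_one]
  push_cast
  ring

omit h3 hf in
/-- The part of the numerator of degree at most `2` in `y = ⟨a⟩ - 1` and `F / a`. -/
theorem sum_numeratorPoly :
    ∑ x ∈ {(0, 0), (1, 0), (2, 0), (0, 1), (0, 2), (1, 1)}, numeratorPoly χ x =
      Polynomial.C (mahlerCoeff χ 0 0) +
      Polynomial.C (mahlerCoeff χ 1 0 - mahlerCoeff χ 2 0 + mahlerCoeff χ 0 1 -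
        mahlerCoeff χ 0 2) * Polynomial.X +
      Polynomial.C (mahlerCoeff χ 2 0 + mahlerCoeff χ 0 2 + mahlerCoeff χ 1 1) *
        Polynomial.X ^ 2 := by
  have : ∀ h : ℕ × ℕ → Polynomial ℂ_[p],
      ∑ x ∈ {(0, 0), (1, 0), (2, 0), (0, 1), (0, 2), (1, 1)}, h x =
        h (0, 0) + (h (1, 0) + (h (2, 0) + (h (0, 1) + (h (0, 2) + h (1, 1))))) := fun h => by
    repeat rw [Finset.sum_insert (by decide)]
    rw [Finset.sum_singleton]
  rw [this]
  simp only [numeratorPoly, descPochhammer_zero, descPochhammer_one, descPochhammer_two]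
  simp only [map_sub, map_add]
  ring

omit h3 hf in
theorem coeff_quadratic (a b c : ℂ_[p]) :
    (Polynomial.C a + Polynomial.C b * Polynomial.X +
      Polynomial.C c * Polynomial.X ^ 2).coeff 1 = b ∧
    (Polynomial.C a + Polynomial.C b * Polynomial.X +
      Polynomial.C c * Polynomial.X ^ 2).coeff 2 = c ∧
    ∀ i, (Polynomial.C a + Polynomial.C b * Polynomial.X +
      Polynomial.C c * Polynomial.X ^ 2).coeff (i + 3) = 0 := by
  simp [Polynomial.coeff_X_pow, Polynomial.coeff_C]

theorem norm_numeratorCoeff_one_sub_le :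
    ‖numeratorCoeff χ 1 - (mahlerCoeff χ 1 0 - mahlerCoeff χ 2 0 + mahlerCoeff χ 0 1 -
        mahlerCoeff χ 0 2)‖ ≤ (p : ℝ)⁻¹ ^ 2 := by
  have h := norm_numeratorCoeff_sub_le χ h3 hf 1
  rw [← Polynomial.finsetSum_coeff, sum_numeratorPoly] at h
  rwa [(coeff_quadratic _ _ _).1] at h

theorem norm_numeratorCoeff_two_sub_le :
    ‖numeratorCoeff χ 2 - (mahlerCoeff χ 2 0 + mahlerCoeff χ 0 2 + mahlerCoeff χ 1 1)‖ ≤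
      (p : ℝ)⁻¹ ^ 2 := by
  have h := norm_numeratorCoeff_sub_le χ h3 hf 2
  rw [← Polynomial.finsetSum_coeff, sum_numeratorPoly] at h
  rwa [(coeff_quadratic _ _ _).2.1] at h

theorem norm_numeratorCoeff_add_three_le (i : ℕ) :
    ‖numeratorCoeff χ (i + 3)‖ ≤ (p : ℝ)⁻¹ ^ 2 := by
  have h := norm_numeratorCoeff_sub_le χ h3 hf (i + 3)
  rw [← Polynomial.finsetSum_coeff, sum_numeratorPoly] at h
  rwa [(coeff_quadratic _ _ _).2.2, sub_zero] at h

theorem norm_numeratorCoeff_one_le : ‖numeratorCoeff χ 1‖ ≤ 1 := by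
  have hle := fun k j (h : 0 + 1 ≤ min k 3 + min j 3) => norm_mahlerCoeff_le_pow χ h3 hf h
  simp only [pow_zero] at hle
  rw [← sub_add_cancel (numeratorCoeff χ 1) (mahlerCoeff χ 1 0 - mahlerCoeff χ 2 0 +
    mahlerCoeff χ 0 1 - mahlerCoeff χ 0 2)]
  exact norm_add_le_of_ultrametric
    ((norm_numeratorCoeff_one_sub_le χ h3 hf).trans (pow_le_one₀ inv_p_pos.le inv_p_lt_one.le))
    (norm_sub_le_of_ultrametric (norm_add_le_of_ultrametric (norm_sub_le_of_ultrametric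
      (hle 1 0 (by decide)) (hle 2 0 (by decide))) (hle 0 1 (by decide))) (hle 0 2 (by decide)))

theorem norm_numeratorCoeff_two_le : ‖numeratorCoeff χ 2‖ ≤ (p : ℝ)⁻¹ := by
  have hle := fun k j (h : 1 + 1 ≤ min k 3 + min j 3) => norm_mahlerCoeff_le_pow χ h3 hf h
  simp only [pow_one] at hle
  rw [← sub_add_cancel (numeratorCoeff χ 2) (mahlerCoeff χ 2 0 + mahlerCoeff χ 0 2 +
    mahlerCoeff χ 1 1)]
  exact norm_add_le_of_ultrametric ((norm_numeratorCoeff_two_sub_le χ h3 hf).trans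
      (pow_le_of_le_one inv_p_pos.le inv_p_lt_one.le two_ne_zero))
    (norm_add_le_of_ultrametric (norm_add_le_of_ultrametric
      (hle 2 0 (by decide)) (hle 0 2 (by decide))) (hle 1 1 (by decide)))

/-- The constant term `a_0` of the Laurent expansion modulo `p ^ 2`. -/
theorem norm_numeratorCoeff_one_sub_restrictedAverage_le :
    ‖numeratorCoeff χ 1 - restrictedAverage p χ (fun n =>
        1 / ((p : ℂ_[p]) - 1) * (p * fermatQuot p n - p ^ 2 * fermatQuot p n ^ 2 / 2)
          - 1 / 2 * ((Nat.lcm f p : ℂ_[p]) / n)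
          - 1 / 12 * ((Nat.lcm f p : ℂ_[p]) / n) ^ 2)‖ ≤ (p : ℝ)⁻¹ ^ 2 := by
  rw [← sub_add_sub_cancel (numeratorCoeff χ 1) (mahlerCoeff χ 1 0 - mahlerCoeff χ 2 0 +
    mahlerCoeff χ 0 1 - mahlerCoeff χ 0 2)]
  refine norm_add_le_of_ultrametric (norm_numeratorCoeff_one_sub_le χ h3 hf) ?_
  simp only [mahlerCoeff, restrictedAverage_sub, restrictedAverage_add]
  rw [← restrictedAverage_sub]
  refine norm_restrictedAverage_sub_le χ hf fun a ha => ?_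
  rw [norm_sub_rev]
  refine (congrArg norm ?_).trans_le (norm_fermatQuot_log_sub_le h3 ha)
  rw [bernoulli_zero, bernoulli_one, bernoulli_two]
  norm_num [Nat.factorial]
  ring

/-- The linear coefficient `a_1` of the Laurent expansion modulo `p ^ 2`. -/
theorem norm_numeratorCoeff_two_sub_restrictedAverage_le :
    ‖numeratorCoeff χ 2 - restrictedAverage p χ (fun n =>
        p ^ 2 * fermatQuot p n ^ 2 / (2 * ((p : ℂ_[p]) - 1) ^ 2)
          + (Nat.lcm f p : ℂ_[p]) ^ 2 / (12 * (n : ℂ_[p]) ^ 2)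
          - p * fermatQuot p n / (2 * ((p : ℂ_[p]) - 1)) * ((Nat.lcm f p : ℂ_[p]) / n))‖ ≤
      (p : ℝ)⁻¹ ^ 2 := by
  rw [← sub_add_sub_cancel (numeratorCoeff χ 2) (mahlerCoeff χ 2 0 + mahlerCoeff χ 0 2 +
    mahlerCoeff χ 1 1)]
  refine norm_add_le_of_ultrametric (norm_numeratorCoeff_two_sub_le χ h3 hf) ?_
  simp only [mahlerCoeff, restrictedAverage_add]
  refine norm_restrictedAverage_sub_le χ hf fun a ha => ?_
  rw [norm_sub_rev]
  refine (congrArg norm ?_).trans_le (norm_sub_le_of_ultrametric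
    (norm_fermatQuot_sq_sub_le h3 ha) (norm_fermatQuot_mul_sub_le h3 ha (norm_lcm_div hf ha)))
  rw [bernoulli_zero, bernoulli_one, bernoulli_two, div_pow]
  norm_num [Nat.factorial]
  ring

end Numerator

/-! ### Existence and uniqueness of the `p`-adic `L`-function -/

section KubotaLeopoldt

variable {p : ℕ} [hp : Fact p.Prime] {f : ℕ}

theorem hasSum_of_eq {g h : ℕ → ℂ_[p]} {S T : ℂ_[p]} (hh : HasSum h T) (hgh : ∀ i, g i = h i)
    (hST : S = T) : HasSum g S := by
  rwa [funext hgh, hST]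

/-- A Laurent expansion on `ℤ_p` is determined by the values of the function at `1 - n`, `n ≥ 1`. -/
theorem HasLaurentExpansionAtOne.unique {L₁ L₂ : ℤ_[p] → ℂ_[p]} {c₁ c₂ : ℂ_[p]}
    {a₁ a₂ : ℕ → ℂ_[p]} (h₁ : HasLaurentExpansionAtOne p L₁ c₁ a₁)
    (h₂ : HasLaurentExpansionAtOne p L₂ c₂ a₂)
    (h : ∀ n : ℕ, 1 ≤ n → L₁ (1 - (n : ℤ_[p])) = L₂ (1 - (n : ℤ_[p]))) : L₁ = L₂ := by
  -- the power series of `s (L₁(1 - s) - L₂(1 - s))`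
  set b : ℕ → ℂ_[p] := fun i => Nat.casesOn i (c₁ - c₂) fun i => a₁ i - a₂ i with hb
  have hsum : ∀ n : ℕ, 1 ≤ n → HasSum (fun i => b i * (n : ℂ_[p]) ^ i) 0 := fun n hn => by
    have hn0 : (n : ℤ_[p]) ≠ 0 := Nat.cast_ne_zero.mpr (by omega)
    have hn1 : (n : ℂ_[p]) ≠ 0 := Nat.cast_ne_zero.mpr (by omega)
    have hd := ((h₁.1 n (Or.inl hn0)).sub (h₂.1 n (Or.inl hn0))).mul_left (n : ℂ_[p])
    rw [← hasSum_nat_add_iff' 1]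
    rw [h n hn, toCp_natCast] at hd
    refine hasSum_of_eq hd (fun i => ?_) ?_
    · simp only [hb]
      ring
    · rw [Finset.sum_range_one, show b 0 = c₁ - c₂ from rfl]
      field_simp
      ring
  have hb0 : b = 0 := by
    refine eq_zero_of_hasSum_zero (u := fun k => ((p ^ k : ℕ) : ℂ_[p]))
      (by simpa using (hsum 1 le_rfl).summable)
      (fun k => Nat.cast_ne_zero.mpr (pow_ne_zero k hp.out.ne_zero))
      (fun k => norm_natCast_le_one p _) ?_
      (fun k => hsum _ (Nat.one_le_pow _ _ hp.out.pos))
    simp only [Nat.cast_pow]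
    exact tendsto_pow_atTop_nhds_zero_of_norm_lt_one (by rw [norm_p]; exact inv_p_lt_one)
  have hc : c₁ = c₂ := sub_eq_zero.mp (congrFun hb0 0)
  have ha : a₁ = a₂ := funext fun i => sub_eq_zero.mp (congrFun hb0 (i + 1))
  subst hc ha
  have key : ∀ s : ℤ_[p], L₁ (1 - s) = L₂ (1 - s) := fun s => by
    by_cases hs : s ≠ 0 ∨ c₁ = 0
    · exact sub_left_injective ((h₁.1 s hs).unique (h₂.1 s hs))
    · push Not at hs
      rw [hs.1, sub_zero, h₁.2 hs.2, h₂.2 hs.2]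
  funext u
  simpa using key (1 - u)

theorem IsKubotaLeopoldt.unique {χ : DirichletCharacter ℂ_[p] f} {L₁ L₂ : ℤ_[p] → ℂ_[p]}
    (h₁ : IsKubotaLeopoldt p χ L₁) (h₂ : IsKubotaLeopoldt p χ L₂) : L₁ = L₂ := by
  obtain ⟨c₁, a₁, e₁⟩ := h₁.meromorphic
  obtain ⟨c₂, a₂, e₂⟩ := h₂.meromorphic
  exact e₁.unique e₂ fun n hn => (h₁.interpolation n hn).trans (h₂.interpolation n hn).symm

variable (χ : DirichletCharacter ℂ_[p] f)

open scoped Classical in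
/-- The `p`-adic `L`-function: the numerator at `s = 1 - u` divided by `s`, continued to `u = 1`
when the numerator vanishes there, and with value `0` at the pole otherwise. -/
def padicLFunction (u : ℤ_[p]) : ℂ_[p] :=
  if u = 1 then (if numeratorCoeff χ 0 = 0 then numeratorCoeff χ 1 else 0)
  else (∑' x, (numeratorPoly χ x).eval (toCp p (1 - u))) / toCp p (1 - u)

theorem hasLaurentExpansionAtOne_padicLFunction (h3 : 3 < p) (hf : ¬ p ^ 2 ∣ f) :
    HasLaurentExpansionAtOne p (padicLFunction χ) (numeratorCoeff χ 0)
      (fun i => numeratorCoeff χ (i + 1)) := by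
  refine ⟨fun s hs => ?_, fun hc => by simp [padicLFunction, hc]⟩
  rcases eq_or_ne s 0 with rfl | hs0
  · have hc := hs.resolve_left (by simp)
    simp only [padicLFunction, sub_zero, if_true, hc, toCp_zero, div_zero]
    convert hasSum_single 0 fun i hi => ?_
    · simp
    · simp [hi]
  · have hs1 : toCp p s ≠ 0 := fun h => hs0 ((toCp_eq_zero p).mp h)
    have hne : (1 : ℤ_[p]) - s ≠ 1 := fun h => hs0 (by simpa using h)
    have h := ((hasSum_nat_add_iff' 1).mpr
      (hasSum_numeratorCoeff χ h3 hf (norm_toCp_le_one p s))).mul_right (toCp p s)⁻¹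
    simp only [padicLFunction, if_neg hne, sub_sub_cancel]
    refine hasSum_of_eq h (fun i => ?_) ?_
    · rw [pow_succ, ← mul_assoc, mul_inv_cancel_right₀ hs1]
    · rw [Finset.sum_range_one, pow_zero, mul_one]
      field_simp

theorem isKubotaLeopoldt_padicLFunction [NeZero f] (hχ : χ.IsPrimitive) (h3 : 3 < p)
    (hf : ¬ p ^ 2 ∣ f) : IsKubotaLeopoldt p χ (padicLFunction χ) where
  meromorphic := ⟨_, _, hasLaurentExpansionAtOne_padicLFunction χ h3 hf⟩
  analytic_of_ne_one h1 := ⟨fun i => numeratorCoeff χ (i + 1), by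
    have h := hasLaurentExpansionAtOne_padicLFunction χ h3 hf
    rwa [numeratorCoeff_zero, restrictedAverage_one_eq_zero χ h1] at h⟩
  interpolation n hn := by
    have hn0 : (n : ℤ_[p]) ≠ 0 := Nat.cast_ne_zero.mpr (by omega)
    have hne : (1 : ℤ_[p]) - n ≠ 1 := fun h => hn0 (by simpa using h)
    simp only [padicLFunction, if_neg hne, sub_sub_cancel, toCp_natCast]
    rw [tsum_numeratorPoly_eval_eq_genBernoulli χ hχ hn]
    ring

theorem isKubotaLeopoldt_kubotaLeopoldt [NeZero f] (hχ : χ.IsPrimitive) (h3 : 3 < p)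
    (hf : ¬ p ^ 2 ∣ f) : IsKubotaLeopoldt p χ (kubotaLeopoldt p χ) :=
  Classical.epsilon_spec ⟨_, isKubotaLeopoldt_padicLFunction χ hχ h3 hf⟩

theorem hasLaurentExpansionAtOne_kubotaLeopoldt [NeZero f] (hχ : χ.IsPrimitive) (h3 : 3 < p)
    (hf : ¬ p ^ 2 ∣ f) : HasLaurentExpansionAtOne p (kubotaLeopoldt p χ) (numeratorCoeff χ 0)
      (fun i => numeratorCoeff χ (i + 1)) := by
  rw [(isKubotaLeopoldt_kubotaLeopoldt χ hχ h3 hf).unique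
    (isKubotaLeopoldt_padicLFunction χ hχ h3 hf)]
  exact hasLaurentExpansionAtOne_padicLFunction χ h3 hf

end KubotaLeopoldt

/-! ### Congruences -/

section Congruences

variable {p : ℕ} [hp : Fact p.Prime]

theorem p_ne_zero : (p : ℂ_[p]) ≠ 0 := Nat.cast_ne_zero.mpr hp.out.ne_zero

theorem padicCongr_p_sq {x y : ℂ_[p]} : PadicCongr p x y (p ^ 2) ↔ ‖x - y‖ ≤ (p : ℝ)⁻¹ ^ 2 := by
  rw [padicCongr_iff p (pow_ne_zero 2 p_ne_zero), norm_pow, norm_p]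

theorem padicCongr_p {x y : ℂ_[p]} : PadicCongr p x y p ↔ ‖x - y‖ ≤ (p : ℝ)⁻¹ := by
  rw [padicCongr_iff p p_ne_zero, norm_p]

/-- The terms of degree at least `2` of a power series with coefficients in `p ^ 2` are negligible
modulo `p ^ 2`. -/
theorem norm_sub_linear_le {a : ℕ → ℂ_[p]} (ha : ∀ i, ‖a (i + 2)‖ ≤ (p : ℝ)⁻¹ ^ 2) {s S : ℂ_[p]}
    (hs : ‖s‖ ≤ 1) (h : HasSum (fun i => a i * s ^ i) S) :
    ‖S - (a 0 + a 1 * s)‖ ≤ (p : ℝ)⁻¹ ^ 2 := by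
  have h2 := (hasSum_nat_add_iff' 2).mpr h
  rw [Finset.sum_range_succ, Finset.sum_range_one, pow_zero, mul_one, pow_one] at h2
  rw [← h2.tsum_eq]
  refine IsUltrametricDist.norm_tsum_le_of_forall_le_of_nonneg (pow_pos inv_p_pos _).le fun i => ?_
  rw [norm_mul, norm_pow]
  exact (mul_le_of_le_one_right (norm_nonneg _) (pow_le_one₀ (norm_nonneg _) hs)).trans (ha i)

/-- Values that are linear in `m` modulo `p ^ 2`, with slope divisible by `p`, are constant
modulo `p`. -/
theorem padicCongr_of_linear {a₀ a₁ : ℂ_[p]} (h1 : ‖a₁‖ ≤ (p : ℝ)⁻¹) {Φ : ℤ → ℂ_[p]}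
    (hΦ : ∀ m : ℤ, ‖Φ m - (a₀ + a₁ * m)‖ ≤ (p : ℝ)⁻¹ ^ 2) (m n : ℤ) :
    PadicCongr p (Φ m) (Φ n) p ∧ PadicCongr p (Φ m) (Φ n + a₁ * ((m : ℂ_[p]) - n)) (p ^ 2) := by
  have h2 : ‖Φ m - (Φ n + a₁ * ((m : ℂ_[p]) - n))‖ ≤ (p : ℝ)⁻¹ ^ 2 := by
    rw [show Φ m - (Φ n + a₁ * ((m : ℂ_[p]) - n)) =
      (Φ m - (a₀ + a₁ * m)) - (Φ n - (a₀ + a₁ * n)) by ring]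
    exact norm_sub_le_of_ultrametric (hΦ m) (hΦ n)
  refine ⟨padicCongr_p.mpr ?_, padicCongr_p_sq.mpr h2⟩
  rw [show Φ m - Φ n = (Φ m - (Φ n + a₁ * ((m : ℂ_[p]) - n))) + a₁ * ((m - n : ℤ) : ℂ_[p]) by
    push_cast; ring]
  refine norm_add_le_of_ultrametric
    (h2.trans (pow_le_of_le_one inv_p_pos.le inv_p_lt_one.le two_ne_zero)) ?_
  rw [norm_mul]
  exact (mul_le_of_le_one_right (norm_nonneg _) (norm_intCast_le_one p _)).trans h1

theorem neBot_nhdsNE_one : (𝓝[≠] (1 : ℤ_[p])).NeBot := by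
  have h : Tendsto (fun k : ℕ => 1 + (p : ℤ_[p]) ^ k) atTop (𝓝[≠] 1) := by
    refine tendsto_nhdsWithin_iff.mpr ⟨?_, Eventually.of_forall fun k => ?_⟩
    · have h0 : Tendsto (fun k : ℕ => (p : ℤ_[p]) ^ k) atTop (𝓝 0) :=
        tendsto_pow_atTop_nhds_zero_of_norm_lt_one (by rw [PadicInt.norm_p]; exact inv_p_lt_one)
      simpa using h0.const_add 1
    · simp [hp.out.ne_zero]
  exact h.neBot

/-- Once the polar part is removed, the limit at the pole is the constant term. -/
theorem hasSum_padicZetaStar {a : ℕ → ℂ_[p]} (ha : ∀ i, ‖a i‖ ≤ 1)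
    (h : HasLaurentExpansionAtOne p (kubotaLeopoldt p (1 : DirichletCharacter ℂ_[p] 1))
      ((p : ℂ_[p])⁻¹ - 1) a) (s : ℤ_[p]) :
    HasSum (fun i : ℕ => a i * toCp p s ^ i) (padicZetaStar p (1 - s)) := by
  set g : ℤ_[p] → ℂ_[p] := fun v =>
    kubotaLeopoldt p (1 : DirichletCharacter ℂ_[p] 1) v + (1 - (p : ℂ_[p])⁻¹) / toCp p (1 - v)
    with hg
  have hsum : ∀ s : ℤ_[p], s ≠ 0 → HasSum (fun i : ℕ => a i * toCp p s ^ i) (g (1 - s)) :=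
    fun s hs => by
      convert h.1 s (Or.inl hs) using 1
      simp only [hg, sub_sub_cancel]
      ring
  rcases eq_or_ne s 0 with rfl | hs
  · have hlim : Tendsto g (𝓝[≠] 1) (𝓝 (a 0)) := by
      have hbound : ∀ v : ℤ_[p], v ≠ 1 → ‖g v - a 0‖ ≤ ‖1 - v‖ := fun v hv => by
        have h1 := (hasSum_nat_add_iff' 1).mpr (hsum (1 - v) (sub_ne_zero.mpr hv.symm))
        rw [Finset.sum_range_one, pow_zero, mul_one, sub_sub_cancel] at h1
        rw [← h1.tsum_eq]
        refine IsUltrametricDist.norm_tsum_le_of_forall_le_of_nonneg (norm_nonneg _) fun i => ?_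
        rw [norm_mul, norm_pow, norm_toCp]
        exact (mul_le_of_le_one_left (by positivity) (ha _)).trans
          (pow_le_of_le_one (norm_nonneg _) (PadicInt.norm_le_one _) (by omega))
      rw [tendsto_iff_norm_sub_tendsto_zero]
      have h0 : Tendsto (fun v : ℤ_[p] => ‖1 - v‖) (𝓝[≠] 1) (𝓝 0) := by
        have : Continuous fun v : ℤ_[p] => ‖1 - v‖ := by fun_prop
        simpa using (this.tendsto 1).mono_left nhdsWithin_le_nhds
      refine squeeze_zero' (Eventually.of_forall fun _ => norm_nonneg _) ?_ h0
      filter_upwards [self_mem_nhdsWithin] with v hv using hbound v hv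
    have := neBot_nhdsNE_one (p := p)
    rw [sub_zero, padicZetaStar, if_pos rfl, hlim.limUnder_eq]
    convert hasSum_single 0 fun i hi => ?_
    · simp
    · simp [hi]
  · rw [padicZetaStar, if_neg fun h => hs (by simpa using h)]
    exact hsum s hs

end Congruences

end

theorem mainTheorem8 (p : ℕ) [Fact p.Prime] (hp : 3 < p) (f : ℕ) [NeZero f]
    (χ : DirichletCharacter ℂ_[p] f) (hχ : χ.IsPrimitive) (hf : ¬ p ^ 2 ∣ f) :
    -- the `p`-adic `L`-function exists and is determined by its defining properties
    (∃! L : ℤ_[p] → ℂ_[p], IsKubotaLeopoldt p χ L) ∧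
    IsKubotaLeopoldt p χ (kubotaLeopoldt p χ) ∧
    -- its Laurent coefficients `c = a_{-1}`, `a 0`, `a 1`
    ∃ (c : ℂ_[p]) (a : ℕ → ℂ_[p]),
      HasLaurentExpansionAtOne p (kubotaLeopoldt p χ) c a ∧
      c = restrictedAverage p χ (fun _ => 1) ∧
      (χ ≠ 1 → c = 0) ∧
      (χ = 1 → c = (p : ℂ_[p])⁻¹ - 1) ∧
      ‖a 0‖ ≤ 1 ∧
      ‖a 1‖ < 1 ∧
      PadicCongr p (a 0)
        (restrictedAverage p χ fun n =>
          1 / ((p : ℂ_[p]) - 1) * (p * fermatQuot p n - p ^ 2 * fermatQuot p n ^ 2 / 2)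
            - 1 / 2 * ((Nat.lcm f p : ℂ_[p]) / n)
            - 1 / 12 * ((Nat.lcm f p : ℂ_[p]) / n) ^ 2)
        (p ^ 2) ∧
      PadicCongr p (a 1)
        (restrictedAverage p χ fun n =>
          p ^ 2 * fermatQuot p n ^ 2 / (2 * ((p : ℂ_[p]) - 1) ^ 2)
            + (Nat.lcm f p : ℂ_[p]) ^ 2 / (12 * (n : ℂ_[p]) ^ 2)
            - p * fermatQuot p n / (2 * ((p : ℂ_[p]) - 1)) * ((Nat.lcm f p : ℂ_[p]) / n))
        (p ^ 2) ∧
      -- the approximation modulo `p ^ 2` (the pole `s = 0` is excluded if `χ` is principal)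
      (∀ s : ℤ_[p], (χ ≠ 1 ∨ s ≠ 0) →
        PadicCongr p (kubotaLeopoldt p χ (1 - s)) (c / toCp p s + a 0 + a 1 * toCp p s)
          (p ^ 2)) ∧
      -- congruences between values at integers
      (χ ≠ 1 → ∀ m n : ℤ,
        PadicCongr p (kubotaLeopoldt p χ (1 - m)) (kubotaLeopoldt p χ (1 - n)) p ∧
        PadicCongr p (kubotaLeopoldt p χ (1 - m))
          (kubotaLeopoldt p χ (1 - n) + a 1 * ((m : ℂ_[p]) - n)) (p ^ 2)) ∧
      (χ = 1 →
        (∀ s : ℤ_[p], HasSum (fun i : ℕ => a i * toCp p s ^ i) (padicZetaStar p (1 - s))) ∧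
        ∀ m n : ℤ,
          PadicCongr p (padicZetaStar p (1 - m)) (padicZetaStar p (1 - n)) p ∧
          PadicCongr p (padicZetaStar p (1 - m))
            (padicZetaStar p (1 - n) + a 1 * ((m : ℂ_[p]) - n)) (p ^ 2)) := by

  set a : ℕ → ℂ_[p] := fun i => numeratorCoeff χ (i + 1) with ha
  have hKL := isKubotaLeopoldt_kubotaLeopoldt χ hχ hp hf
  have hL : HasLaurentExpansionAtOne p (kubotaLeopoldt p χ) (numeratorCoeff χ 0) a :=
    hasLaurentExpansionAtOne_kubotaLeopoldt χ hχ hp hf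
  have hc0 : χ ≠ 1 → numeratorCoeff χ 0 = 0 := fun h => by
    rw [numeratorCoeff_zero, restrictedAverage_one_eq_zero χ h]
  have hf1 : χ = 1 → f = 1 := fun h => by
    rw [← (DirichletCharacter.isPrimitive_def χ).mp hχ, h, DirichletCharacter.conductor_one]
  have hc1 : χ = 1 → numeratorCoeff χ 0 = (p : ℂ_[p])⁻¹ - 1 := fun h => by
    obtain rfl := hf1 h
    rw [numeratorCoeff_zero, h, restrictedAverage_one_one]
  have ha0 : ‖a 0‖ ≤ 1 := norm_numeratorCoeff_one_le χ hp hf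
  have ha1 : ‖a 1‖ ≤ (p : ℝ)⁻¹ := norm_numeratorCoeff_two_le χ hp hf
  have ha2 : ∀ i, ‖a (i + 2)‖ ≤ (p : ℝ)⁻¹ ^ 2 := norm_numeratorCoeff_add_three_le χ hp hf
  -- at `s = 0` there is no pole if `χ ≠ 1`, and the junk value `c / 0 = 0` is the right one
  have hlin : ∀ s : ℤ_[p], (χ ≠ 1 ∨ s ≠ 0) →
      ‖kubotaLeopoldt p χ (1 - s) - (numeratorCoeff χ 0 / toCp p s + a 0 + a 1 * toCp p s)‖ ≤
        (p : ℝ)⁻¹ ^ 2 := fun s hs => by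
    have h := norm_sub_linear_le ha2 (norm_toCp_le_one p s) (hL.1 s (hs.symm.imp_right hc0))
    rwa [sub_sub, ← add_assoc] at h
  refine ⟨⟨_, hKL, fun L h => h.unique hKL⟩, hKL, numeratorCoeff χ 0, a, hL,
    numeratorCoeff_zero χ, hc0, hc1, ha0, ha1.trans_lt inv_p_lt_one,
    padicCongr_p_sq.mpr (norm_numeratorCoeff_one_sub_restrictedAverage_le χ hp hf),
    padicCongr_p_sq.mpr (norm_numeratorCoeff_two_sub_restrictedAverage_le χ hp hf),
    fun s hs => padicCongr_p_sq.mpr (hlin s hs), fun h1 => ?_, fun h1 => ?_⟩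
  · refine padicCongr_of_linear (Φ := fun m => kubotaLeopoldt p χ (1 - m)) (a₀ := a 0) ha1
      fun m => ?_
    have h := hlin m (Or.inl h1)
    rwa [hc0 h1, zero_div, zero_add, toCp_intCast] at h
  · have hz : ∀ s : ℤ_[p],
        HasSum (fun i : ℕ => a i * toCp p s ^ i) (padicZetaStar p (1 - s)) := by
      refine hasSum_padicZetaStar (fun i => ?_) ?_
      · match i with
        | 0 => exact ha0
        | 1 => exact ha1.trans inv_p_lt_one.le
        | i + 2 => exact (ha2 i).trans (pow_le_one₀ inv_p_pos.le inv_p_lt_one.le)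
      · rw [hc1 h1] at hL
        clear_value a
        obtain rfl := hf1 h1
        rwa [h1] at hL
    refine ⟨hz, padicCongr_of_linear (Φ := fun m => padicZetaStar p (1 - m)) (a₀ := a 0) ha1
      fun m => ?_⟩
    have h := norm_sub_linear_le ha2 (norm_toCp_le_one p m) (hz m)
    rwa [toCp_intCast] at h
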